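/- **Conventions.** $|\cdot|$ is the Euclidean norm, $\bar{\mathbb R}=[-\infty,+\infty]$, and $\partial h$ is the limiting (Mordukhovich) subdifferential of $h:\mathbb R^m\to\bar{\mathbb R}$, which is empty at points where $h$ is not finite. $\operatorname{par}S$ is the linear subspace parallel to the affine span of $S$, $\operatorname{ri}$ is the relative interior, and $h$ is *subdifferentially regular* at $z$ if $h(z)$ is finite and $\operatorname{epi}h$ is Clarke regular at $(z,h(z))$. The function $h$ is *prox-regular* at $\bar c$ if for every $\bar v\in\partial h(\bar c)$: $h$ is finite at $\bar c$, lower semicontinuous around $\bar c$, and there is $\rho>0$ such that $h(z)\ge h(y)+\langle w,z-y\rangle-\frac\rho2|z-y|^2$ whenever $y,z$ are near $\bar c$, $h(y)$ is near $h(\bar c)$, and $w\in\partial h(y)$ is near $\bar v$. The function $h$ is *partly smooth* at $\bar c$ relative to a set $\mathcal M\ni\bar c$ if: near $\bar c$, $\mathcal M$ is the zero set of a map $F:\mathbb R^m\to\mathbb R^k$ that is $C^2$ around $\bar c$ with $\nabla F(\bar c)$ surjective; $h|_{\mathcal M}$ is $C^2$ near $\bar c$ (it agrees near $\bar c$ on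 $\mathcal M$ with a $C^2$ function); $h$ is subdifferentially regular with $\partial h(z)\neq\emptyset$ at all $z\in\mathcal M$ near $\bar c$; $\operatorname{par}\partial h(\bar c)=\operatorname{Range}(\nabla F(\bar c)^*)$; and the set-valued map $\partial h$, restricted to $\mathcal M$, is continuous (outer and inner semicontinuous) at $\bar c$. **Theorem.** Let $h:\mathbb R^m\to\bar{\mathbb R}$, and let $c:\mathbb R^n\to\mathbb R^m$ be $C^2$ around $\bar x$. Put $\bar c=c(\bar x)$. Suppose that $h$ is prox-regular at $\bar c$ and partly smooth there relative to $\mathcal M$, and that $$\operatorname{par}\partial h(\bar c)\cap\operatorname{Null}(\nabla c(\bar x)^*)=\{0\},\qquad \operatorname{ri}\partial h(\bar c)\cap\operatorname{Null}(\nabla c(\bar x)^*)\neq\emptyset .$$ Write $h_{x,\mu}(d)=h\big(c(x)+\nabla c(x)d\big)+\frac\mu2|d|^2$. For sequences $x_r\to\bar x$ and $\mu_r>0$, call $(d_r)$ a *small critical sequence* if $$0\in\partial h_{x_r,\mu_r}(d_r)\ \text{ for all large } r,\qquad d_r=O(|x_r-\bar x|),\qquad h\big(c(x_r)+\nabla c(x_r)d_r\big)\to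 h(\bar c).$$ For a constant $\gamma\ge0$, let $(\ast)_\gamma$ be the assertion that, for all large $r$, $c(x_r)+\nabla c(x_r)d_r\in\mathcal M$ and there is a point $x_r^{\rm new}$ with $$c(x_r^{\rm new})\in\mathcal M,\qquad |x_r^{\rm new}-(x_r+d_r)|\le\gamma|d_r|^2,\qquad h\big(c(x_r^{\rm new})\big)\le h\big(c(x_r)+\nabla c(x_r)d_r\big)+\gamma|d_r|^2 .$$ (1) There are constants $\hat\mu,\gamma\ge0$ such that, for all sequences with $\mu_r>\hat\mu$ for all $r$, $x_r\to\bar x$ and $\mu_r|x_r-\bar x|\to0$, there is a small critical sequence $(d_r)$. Its terms are local minimizers of $h_{x_r,\mu_r}$ for all large $r$, any other small critical sequence coincides with it for all large $r$, and it satisfies $(\ast)_\gamma$. (2) If $h:\mathbb R^m\to(-\infty,+\infty]$ is convex and lower semicontinuous, one can take $\hat\mu=0$ in the following sense. There is $\gamma\ge0$ such that, for all sequences with $\mu_r>0$ for all $r$, $x_r\to\bar x$ and $\mu_r|x_r-\bar x|\to0$: every small critical sequence $(d_r)$ consists of local minimizers of $h_{x_r,\mu_r}$ for all large $r$, any two small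 critical sequences coincide for all large $r$, and every small critical sequence satisfies $(\ast)_\gamma$. If moreover $\inf_r\mu_r>0$, then a small critical sequence exists. -/

import Mathlib

open Filter Topology Asymptotics

noncomputable section

namespace ProxLinear

section VariationalAnalysis

variable {E : Type*} [NormedAddCommGroup E] [InnerProductSpace ℝ E]

/-- The extended-real-valued function `h` is finite at `x`. -/
def FiniteAt (h : E → EReal) (x : E) : Prop :=
  h x ≠ ⊤ ∧ h x ≠ ⊥

/-- Regular (Fréchet) subgradients of `h` at `x`: `h` is finite at `x` and
`h z ≥ h x + ⟪v, z - x⟫ + o(‖z - x‖)` as `z → x`. -/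
def regularSubdifferential (h : E → EReal) (x : E) : Set E :=
  {v | FiniteAt h x ∧ ∀ ε : ℝ, 0 < ε → ∀ᶠ z in 𝓝 x,
    h x + ((inner ℝ v (z - x) - ε * ‖z - x‖ : ℝ) : EReal) ≤ h z}

/-- The (limiting) subdifferential `∂h(x)`: limits of regular subgradients at points `u k → x`
with `h (u k) → h x`.  It is empty where `h` is not finite. -/
def subdifferential (h : E → EReal) (x : E) : Set E :=
  {v | FiniteAt h x ∧ ∃ u w : ℕ → E,
    Tendsto u atTop (𝓝 x) ∧ Tendsto (fun k => h (u k)) atTop (𝓝 (h x)) ∧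
    (∀ k, w k ∈ regularSubdifferential h (u k)) ∧ Tendsto w atTop (𝓝 v)}

/-- Regular (Fréchet) normals to `S` at a point `x` of `S`. -/
def regularNormalCone (S : Set E) (x : E) : Set E :=
  {v | x ∈ S ∧ ∀ ε : ℝ, 0 < ε → ∀ᶠ z in 𝓝[S] x, inner ℝ v (z - x) ≤ ε * ‖z - x‖}

/-- The (limiting) normal cone to `S` at a point `x` of `S`. -/
def normalCone (S : Set E) (x : E) : Set E :=
  {v | x ∈ S ∧ ∃ u w : ℕ → E, Tendsto u atTop (𝓝 x) ∧
    (∀ k, w k ∈ regularNormalCone S (u k)) ∧ Tendsto w atTop (𝓝 v)}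

/-- Clarke regularity of a set at one of its points: the set is locally closed there and every
normal is a regular normal. -/
def ClarkeRegularAt (S : Set E) (x : E) : Prop :=
  x ∈ S ∧ (∃ V ∈ 𝓝 x, IsClosed V ∧ IsClosed (S ∩ V)) ∧ normalCone S x = regularNormalCone S x

/-- The epigraph of `h`, in the Euclidean product of `E` and `ℝ`. -/
def epigraph (h : E → EReal) : Set (WithLp 2 (E × ℝ)) :=
  {p | h p.fst ≤ (p.snd : EReal)}

/-- Subdifferential regularity: `h` is finite at `x` and its epigraph is Clarke regular at
`(x, h x)`. -/
def SubdifferentiallyRegularAt (h : E → EReal) (x : E) : Prop :=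
  FiniteAt h x ∧ ClarkeRegularAt (epigraph h) (WithLp.toLp 2 (x, (h x).toReal))

/-- Prox-regularity of `h` at `x` for the subgradient `v`. -/
def ProxRegularAtFor (h : E → EReal) (x v : E) : Prop :=
  FiniteAt h x ∧ (∀ᶠ z in 𝓝 x, LowerSemicontinuousAt h z) ∧
    ∃ ρ : ℝ, 0 < ρ ∧ ∃ ε : ℝ, 0 < ε ∧ ∀ y z w : E,
      ‖y - x‖ < ε → ‖z - x‖ < ε →
      h x - (ε : EReal) < h y → h y < h x + (ε : EReal) →
      w ∈ subdifferential h y → ‖w - v‖ < ε →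
      h y + ((inner ℝ w (z - y) - ρ / 2 * ‖z - y‖ ^ 2 : ℝ) : EReal) ≤ h z

/-- Prox-regularity of `h` at `x`: prox-regularity for every subgradient at `x`. -/
def ProxRegularAt (h : E → EReal) (x : E) : Prop :=
  ∀ v ∈ subdifferential h x, ProxRegularAtFor h x v

/-- The outer limit of the set-valued map `S` at `x` relative to `M`. -/
def outerLimit (S : E → Set E) (M : Set E) (x : E) : Set E :=
  {v | ∀ ε : ℝ, 0 < ε → ∃ᶠ z in 𝓝[M] x, ∃ w ∈ S z, ‖w - v‖ < ε}

/-- The inner limit of the set-valued map `S` at `x` relative to `M`. -/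
def innerLimit (S : E → Set E) (M : Set E) (x : E) : Set E :=
  {v | ∀ ε : ℝ, 0 < ε → ∀ᶠ z in 𝓝[M] x, ∃ w ∈ S z, ‖w - v‖ < ε}

/-- Continuity at `x`, relative to `M`, of the set-valued map `S`: it is outer semicontinuous and
inner semicontinuous there. -/
def SetValuedContinuousWithinAt (S : E → Set E) (M : Set E) (x : E) : Prop :=
  outerLimit S M x ⊆ S x ∧ S x ⊆ innerLimit S M x

/-- `F` defines `M` near `x` as a `C²` manifold: `x ∈ M`, `F` is `C²` around `x` with surjective
derivative at `x`, and near `x` the set `M` is the zero set of `F`. -/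
def IsLocalDefiningMap (M : Set E) (x : E) {k : ℕ} (F : E → EuclideanSpace ℝ (Fin k)) : Prop :=
  x ∈ M ∧ ContDiffAt ℝ 2 F x ∧ Function.Surjective (fderiv ℝ F x) ∧
    ∀ᶠ z in 𝓝 x, z ∈ M ↔ F z = 0

/-- Partial smoothness (of class `C²`) of `h` at `x` relative to `M`.  The normal space to `M` at
`x` is the range of the adjoint of the derivative at `x` of a local defining map (it does not
depend on the choice of that map). -/
def PartlySmoothAt [CompleteSpace E] (h : E → EReal) (M : Set E) (x : E) : Prop :=
  ∃ (k : ℕ) (F : E → EuclideanSpace ℝ (Fin k)),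
    IsLocalDefiningMap M x F ∧
    (∃ g : E → ℝ, ContDiffAt ℝ 2 g x ∧ ∀ᶠ z in 𝓝[M] x, h z = (g z : EReal)) ∧
    (∀ᶠ z in 𝓝[M] x, SubdifferentiallyRegularAt h z ∧ (subdifferential h z).Nonempty) ∧
    (affineSpan ℝ (subdifferential h x)).direction =
      LinearMap.range (ContinuousLinearMap.adjoint (fderiv ℝ F x)).toLinearMap ∧
    SetValuedContinuousWithinAt (subdifferential h) M x

/-- `h : E → (-∞, +∞]` is convex and lower semicontinuous. -/
def ConvexLsc (h : E → EReal) : Prop :=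
  (∀ z, h z ≠ ⊥) ∧ Convex ℝ {p : E × ℝ | h p.1 ≤ (p.2 : EReal)} ∧ LowerSemicontinuous h

end VariationalAnalysis

section Subproblem

variable {n m : ℕ}

/-- The null space of the adjoint of the derivative of `c` at `x`. -/
def nullAdjoint (c : EuclideanSpace ℝ (Fin n) → EuclideanSpace ℝ (Fin m))
    (x : EuclideanSpace ℝ (Fin n)) : Submodule ℝ (EuclideanSpace ℝ (Fin m)) :=
  LinearMap.ker (ContinuousLinearMap.adjoint (fderiv ℝ c x)).toLinearMap

/-- The linearized prediction `c(x) + ∇c(x) d`. -/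
def pred (c : EuclideanSpace ℝ (Fin n) → EuclideanSpace ℝ (Fin m))
    (x d : EuclideanSpace ℝ (Fin n)) : EuclideanSpace ℝ (Fin m) :=
  c x + fderiv ℝ c x d

/-- The objective of the proximal linearized subproblem,
`d ↦ h(c(x) + ∇c(x) d) + (μ/2) ‖d‖²`. -/
def proxObjective (h : EuclideanSpace ℝ (Fin m) → EReal)
    (c : EuclideanSpace ℝ (Fin n) → EuclideanSpace ℝ (Fin m))
    (x : EuclideanSpace ℝ (Fin n)) (μ : ℝ) (d : EuclideanSpace ℝ (Fin n)) : EReal :=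
  h (pred c x d) + ((μ / 2 * ‖d‖ ^ 2 : ℝ) : EReal)

/-- `d` is a sequence of small critical points of the subproblems given by `x r`, `μ r`: for all
large `r` the point `d r` is critical, `d r = O(‖x r - x̄‖)`, and the predicted values
`h(c(x r) + ∇c(x r) (d r))` tend to `h(c(x̄))`. -/
def IsSmallCriticalSeq (h : EuclideanSpace ℝ (Fin m) → EReal)
    (c : EuclideanSpace ℝ (Fin n) → EuclideanSpace ℝ (Fin m))
    (xbar : EuclideanSpace ℝ (Fin n)) (μ : ℕ → ℝ) (x d : ℕ → EuclideanSpace ℝ (Fin n)) : Prop :=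
  (∀ᶠ r in atTop, (0 : EuclideanSpace ℝ (Fin n)) ∈
    subdifferential (proxObjective h c (x r) (μ r)) (d r)) ∧
  d =O[atTop] (fun r => x r - xbar) ∧
  Tendsto (fun r => h (pred c (x r) (d r))) atTop (𝓝 (h (c xbar)))

/-- The step `d` from `x` identifies `M`, and can be corrected, with constant `γ`, to a point
`xnew` mapped into `M` by `c`. -/
def IdentifiesAndCorrects (h : EuclideanSpace ℝ (Fin m) → EReal)
    (c : EuclideanSpace ℝ (Fin n) → EuclideanSpace ℝ (Fin m))
    (M : Set (EuclideanSpace ℝ (Fin m))) (γ : ℝ) (x d : EuclideanSpace ℝ (Fin n)) : Prop :=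
  pred c x d ∈ M ∧ ∃ xnew : EuclideanSpace ℝ (Fin n), c xnew ∈ M ∧
    ‖xnew - (x + d)‖ ≤ γ * ‖d‖ ^ 2 ∧
    h (c xnew) ≤ h (pred c x d) + ((γ * ‖d‖ ^ 2 : ℝ) : EReal)

end Subproblem

end ProxLinear

end

/-! Let A = ∇c(x̄), and let v̄ be a relative interior subgradient of h at c̄ with A*v̄ = 0. The
constraint qualification acts twice. Since par ∂h(c̄) is the normal space of the manifold M, it
makes F ∘ c a submersion at x̄ for a defining map F, so linearized or true values of c can be moved
onto M by a step proportional to the residual of F (`exists_zero_norm_le_of_partial_surjective`). It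
also makes v̄ the only subgradient at c̄ annihilated by A* and, through Clarke regularity of the
epigraph, rules out nonzero horizon directions in the kernel of A*. Hence a small critical point d
has an exact multiplier v ∈ ∂h(c(x) + ∇c(x)d) with ∇c(x)*v = -μd, and v is close to v̄ because μd →
0 (`eventually_exists_multiplier`).

Closeness of v to v̄ controls every small critical sequence. A point off M cannot carry a
subgradient near v̄: moving it onto M along the normal space and tilting v̄ in that direction inside
∂h(c̄) would violate hypomonotonicity (`eventually_mem_manifold`). Prox-regularity at v̄ bounds the
negative curvature of h by ρ, and the proximal term dominates it once μ > ρ(‖A‖+1)²; this gives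
local minimality and uniqueness. On M, the correction to a point with c(x_new) ∈ M costs O(‖d‖²),
the linearization error of c (`exists_correction_constant`).

For existence, minimize over a fixed closed ball (`exists_small_local_min`). Near c̄, h lies above
its v̄-linearization up to -ρ/2 times a square; along M it lies below it up to a square
(`exists_quadratic_upper_bound`). Because A*v̄ = 0, the linear terms are of second order. Comparison
with a step onto M shows that the minimizer has size O(|x - x̄|), so it is interior. In the convex
case ρ = 0, and no threshold on μ remains. -/

namespace ProxLinear

/-! ### Solving nonlinear equations with linear estimates; Taylor bounds -/

section LocalSolvability

/-- Parametric Lyusternik–Graves estimate: if `Ψ` is strictly differentiable at `(p₀, 0)` with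
surjective partial derivative in the second variable, then `Ψ (p, ·) = 0` has a solution of size
`O(‖Ψ (p, 0)‖)` for all `p` near `p₀`. -/
theorem exists_zero_norm_le_of_partial_surjective
    {P D K : Type*} [NormedAddCommGroup P] [NormedSpace ℝ P] [CompleteSpace P]
    [NormedAddCommGroup D] [NormedSpace ℝ D] [CompleteSpace D]
    [NormedAddCommGroup K] [NormedSpace ℝ K] [CompleteSpace K]
    {Ψ : P × D → K} {Ψ' : P × D →L[ℝ] K} {p₀ : P}
    (hΨ : HasStrictFDerivAt Ψ Ψ' (p₀, 0))
    (hsurj : ∀ κ : K, ∃ d : D, Ψ' (0, d) = κ) (h0 : Ψ (p₀, 0) = 0) :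
    ∃ κ : ℝ, 0 ≤ κ ∧ ∀ᶠ p in 𝓝 p₀, ∃ d : D, Ψ (p, d) = 0 ∧ ‖d‖ ≤ κ * ‖Ψ (p, 0)‖ := by
  -- Carrying the parameter along turns the parametric problem into plain local surjectivity of `H`:
  -- a preimage of (p, 0) has first component p.
  set H : P × D → P × K := fun q => (q.1, Ψ q) with hH
  set H' : P × D →L[ℝ] P × K := (ContinuousLinearMap.fst ℝ P D).prod Ψ' with hH'
  have hHs : HasStrictFDerivAt H H' (p₀, 0) := hasStrictFDerivAt_fst.prodMk hΨ
  have hr : H'.range = ⊤ := by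
    refine LinearMap.range_eq_top.2 fun ⟨ξ, k⟩ => ?_
    obtain ⟨d, hd⟩ := hsurj (k - Ψ' (ξ, 0))
    refine ⟨(ξ, d), ?_⟩
    have : Ψ' (ξ, d) = k := by
      have : ((ξ, d) : P × D) = (ξ, 0) + (0, d) := by simp
      rw [this, map_add, hd]; abel
    simp [hH', this]
  set S := H'.nonlinearRightInverseOfSurjective hr
  have hpos : 0 < S.nnnorm := H'.nonlinearRightInverseOfSurjective_nnnorm_pos hr
  -- Half of the surjectivity modulus is spent on the approximation error. The other half remains,
  -- which is why `κ` is twice the norm of the right inverse: the ball of radius κ‖Ψ(p, 0)‖ around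
  -- (p, 0) covers the ball of radius ‖Ψ(p, 0)‖ around (p, Ψ(p, 0)), which contains (p, 0).
  obtain ⟨s, hs, hap⟩ := hHs.approximates_deriv_on_nhds
    (c := (S.nnnorm)⁻¹ / 2) (Or.inr (by positivity))
  obtain ⟨R, hR, hRs⟩ := Metric.mem_nhds_iff.1 hs
  set κ : ℝ := 2 * S.nnnorm
  have hκ : 0 < κ := by positivity
  have hcont : ContinuousAt (fun p : P => Ψ (p, 0)) p₀ :=
    ContinuousAt.comp (f := fun p : P => (p, (0 : D))) (x := p₀) hΨ.continuousAt (by fun_prop)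
  have hsm : ∀ᶠ p in 𝓝 p₀, κ * ‖Ψ (p, 0)‖ < R / 2 := by
    have : Tendsto (fun p : P => κ * ‖Ψ (p, 0)‖) (𝓝 p₀) (𝓝 (κ * ‖Ψ (p₀, 0)‖)) :=
      (hcont.norm.const_mul κ)
    rw [h0, norm_zero, mul_zero] at this
    exact this.eventually_lt_const (by positivity)
  refine ⟨κ, hκ.le, ?_⟩
  filter_upwards [hsm, Metric.ball_mem_nhds p₀ (half_pos hR)] with p hp1 hp2
  have hsub : Metric.closedBall ((p, 0) : P × D) (κ * ‖Ψ (p, 0)‖) ⊆ s := by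
    refine subset_trans (Metric.closedBall_subset_ball' ?_) hRs
    have : dist ((p, 0) : P × D) (p₀, 0) = dist p p₀ := by simp [Prod.dist_eq]
    rw [this]
    have := Metric.mem_ball.1 hp2
    linarith
  have := hap.surjOn_closedBall_of_nonlinearRightInverse S (by positivity) hsub
  obtain ⟨⟨p', d⟩, hq, hq'⟩ := this (show ((p, 0) : P × K) ∈ _ by
    rw [Metric.mem_closedBall, hH]
    have e : ((S.nnnorm : ℝ)⁻¹ - (((S.nnnorm)⁻¹ / 2 : NNReal) : ℝ)) * (κ * ‖Ψ (p, 0)‖)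
        = ‖Ψ (p, 0)‖ := by
      have : (S.nnnorm : ℝ) ≠ 0 := by positivity
      push_cast
      simp only [κ]
      field_simp
      ring
    rw [e]
    simp [dist_eq_norm])
  simp only [hH, Prod.mk.injEq] at hq'
  obtain ⟨rfl, hz⟩ := hq'
  refine ⟨d, hz, ?_⟩
  rw [Metric.mem_closedBall, Prod.dist_eq] at hq
  simpa using hq

/-- Second-order Taylor bounds for a `C²` map. -/
theorem ContDiffAt.exists_quadratic_remainder
    {E F : Type*} [NormedAddCommGroup E] [NormedSpace ℝ E]
    [NormedAddCommGroup F] [NormedSpace ℝ F] {f : E → F} {a : E} (hf : ContDiffAt ℝ 2 f a) :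
    ∃ C : ℝ, 0 ≤ C ∧ ∃ δ : ℝ, 0 < δ ∧ ∀ x y, ‖x - a‖ < δ → ‖y - a‖ < δ →
      ‖fderiv ℝ f y - fderiv ℝ f x‖ ≤ C * ‖y - x‖ ∧
      ‖f y - f x - fderiv ℝ f x (y - x)‖ ≤ C * ‖y - x‖ ^ 2 := by
  obtain ⟨K, t, ht, hK⟩ := (hf.fderiv_right (m := 1) (by norm_num)).exists_lipschitzOnWith
  have hd : ∀ᶠ x in 𝓝 a, DifferentiableAt ℝ f x :=
    (hf.eventually (by simp)).mono fun x hx => hx.differentiableAt (by simp)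
  obtain ⟨δ, hδ, hball⟩ := Metric.mem_nhds_iff.1 (inter_mem ht hd)
  refine ⟨K, K.2, δ, hδ, fun x y hx hy => ?_⟩
  have hmem : ∀ z, ‖z - a‖ < δ → z ∈ t ∧ DifferentiableAt ℝ f z := fun z hz =>
    hball (by rwa [Metric.mem_ball, dist_eq_norm])
  have hlip : ∀ z w, ‖z - a‖ < δ → ‖w - a‖ < δ →
      ‖fderiv ℝ f w - fderiv ℝ f z‖ ≤ K * ‖w - z‖ := fun z w hz hw =>
    hK.norm_sub_le (hmem w hw).1 (hmem z hz).1
  refine ⟨hlip x y hx hy, ?_⟩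
  have hseg : segment ℝ x y ⊆ Metric.ball a δ :=
    (convex_ball a δ).segment_subset (by rwa [Metric.mem_ball, dist_eq_norm])
      (by rwa [Metric.mem_ball, dist_eq_norm])
  have key := Convex.norm_image_sub_le_of_norm_hasFDerivWithin_le' (f := f) (f' := fderiv ℝ f)
    (φ := fderiv ℝ f x) (C := K * ‖y - x‖) (s := segment ℝ x y) (x := x) (y := y)
    (fun z hz => ((hball (hseg hz)).2.hasFDerivAt).hasFDerivWithinAt)
    (fun z hz => by
      refine (hlip x z hx (by simpa [dist_eq_norm] using hseg hz)).trans ?_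
      have : ‖z - x‖ ≤ ‖y - x‖ := by
        have h1 := norm_sub_le_of_mem_segment hz
        simpa [norm_sub_rev] using h1
      exact mul_le_mul_of_nonneg_left this K.2)
    (convex_segment x y) (left_mem_segment ℝ x y) (right_mem_segment ℝ x y)
  calc _ ≤ _ := key
    _ = _ := by ring

end LocalSolvability

/-! ### Subgradients and the convex subgradient inequality -/

section Subgradients

variable {E : Type*} [NormedAddCommGroup E] [InnerProductSpace ℝ E]

theorem FiniteAt.exists_real {α : Type*} {h : α → EReal} {x : α} (hx : FiniteAt h x) :
    ∃ a : ℝ, h x = a :=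
  ⟨(h x).toReal, (EReal.coe_toReal hx.1 hx.2).symm⟩

theorem finiteAt_of_eq_coe {α : Type*} {h : α → EReal} {x : α} {a : ℝ} (hx : h x = a) :
    FiniteAt h x := by
  simp [FiniteAt, hx]

theorem add_coe_le_coe_iff (x : EReal) (r b : ℝ) :
    x + (r : EReal) ≤ (b : EReal) ↔ x ≤ ((b - r : ℝ) : EReal) := by
  rw [EReal.coe_sub, EReal.le_sub_iff_add_le (by simp) (by simp)]

theorem regularSubdifferential_subset_subdifferential (h : E → EReal) (x : E) :
    regularSubdifferential h x ⊆ subdifferential h x := fun v hv =>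
  ⟨hv.1, fun _ => x, fun _ => v, tendsto_const_nhds, tendsto_const_nhds, fun _ => hv,
    tendsto_const_nhds⟩

/-- The local inequality is tested at x + t(z - x), where convexity bounds h by the chord. Both
sides are then linear in t, so division by t gives the global inequality up to ε‖z - x‖, with ε
arbitrary. -/
theorem regularSubgradient_convex_ineq {h : E → EReal} (hh : ConvexLsc h) {x v : E}
    (hv : v ∈ regularSubdifferential h x) (z : E) :
    h x + ((inner ℝ v (z - x) : ℝ) : EReal) ≤ h z := by
  obtain ⟨a, ha⟩ := hv.1.exists_real
  by_cases hz : h z = ⊤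
  · simp [hz]
  obtain ⟨b, hb⟩ : ∃ b : ℝ, h z = b := FiniteAt.exists_real ⟨hz, hh.1 z⟩
  rw [ha, hb]
  norm_cast
  refine le_of_forall_pos_le_add fun η hη => ?_
  set ε := η / (‖z - x‖ + 1)
  have hε : 0 < ε := by positivity
  have hεη : ε * ‖z - x‖ ≤ η := by
    simp only [ε]; rw [div_mul_eq_mul_div, div_le_iff₀ (by positivity)]
    nlinarith [norm_nonneg (z - x)]
  have hline : Tendsto (fun t : ℝ => x + t • (z - x)) (𝓝[>] 0) (𝓝 x) := by
    have : Continuous fun t : ℝ => x + t • (z - x) := by fun_prop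
    have := this.tendsto 0
    simp only [zero_smul, add_zero] at this
    exact this.mono_left nhdsWithin_le_nhds
  have h1 : ∀ᶠ t : ℝ in 𝓝[>] 0, t < 1 :=
    nhdsWithin_le_nhds (eventually_lt_nhds zero_lt_one)
  obtain ⟨t, ht, ht1, ht0⟩ :=
    ((hline.eventually (hv.2 ε hε)).and (h1.and self_mem_nhdsWithin)).exists
  have ht0 : (0 : ℝ) < t := ht0
  have hconv : h (x + t • (z - x)) ≤ ((a + t * (b - a) : ℝ) : EReal) := by
    have := hh.2.1 (show (x, a) ∈ {p : E × ℝ | h p.1 ≤ (p.2 : EReal)} by simp [ha])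
      (show (z, b) ∈ {p : E × ℝ | h p.1 ≤ (p.2 : EReal)} by simp [hb])
      (sub_nonneg.2 ht1.le) ht0.le (by ring)
    simp only [Set.mem_ofPred_eq, Prod.smul_mk, Prod.mk_add_mk, smul_eq_mul] at this
    have e1 : (1 - t) • x + t • z = x + t • (z - x) := by module
    have e2 : (1 - t) * a + t * b = a + t * (b - a) := by ring
    rwa [e1, e2] at this
  have := ht.trans hconv
  rw [ha] at this
  norm_cast at this
  rw [add_sub_cancel_left, inner_smul_right, norm_smul, Real.norm_of_nonneg ht0.le] at this
  have h3 : t * (inner ℝ v (z - x)) ≤ t * (b - a + ε * ‖z - x‖) := by nlinarith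
  have := le_of_mul_le_mul_left h3 ht0
  linarith

/-- Limiting subgradients of a convex function satisfy the global subgradient inequality. -/
theorem subgradient_convex_ineq {h : E → EReal} (hh : ConvexLsc h) {x v : E}
    (hv : v ∈ subdifferential h x) (z : E) :
    h x + ((inner ℝ v (z - x) : ℝ) : EReal) ≤ h z := by
  obtain ⟨-, u, w, hu, hhu, hw, hwv⟩ := hv
  by_cases hz : h z = ⊤
  · simp [hz]
  obtain ⟨b, hb⟩ : ∃ b : ℝ, h z = b := FiniteAt.exists_real ⟨hz, hh.1 z⟩
  rw [hb, add_coe_le_coe_iff]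
  -- With all real terms moved to one side, the limit needs no continuity of addition in `EReal`.
  have hr : Tendsto (fun k => ((b - inner ℝ (w k) (z - u k) : ℝ) : EReal)) atTop
      (𝓝 ((b - inner ℝ v (z - x) : ℝ) : EReal)) :=
    (continuous_coe_real_ereal.tendsto _).comp
      (tendsto_const_nhds.sub (hwv.inner (tendsto_const_nhds.sub hu)))
  refine le_of_tendsto_of_tendsto hhu hr (Eventually.of_forall fun k => ?_)
  have := regularSubgradient_convex_ineq hh (hw k) z
  rwa [hb, add_coe_le_coe_iff] at this

end Subgradients

/-! ### Subgradients as epigraph normals; horizon directions -/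

section Epigraph

variable {E : Type*} [NormedAddCommGroup E] [InnerProductSpace ℝ E]

theorem norm_fst_le_norm {E : Type*} [NormedAddCommGroup E] (p : WithLp 2 (E × ℝ)) :
    ‖p.fst‖ ≤ ‖p‖ := by
  rw [WithLp.prod_norm_eq_of_L2]
  exact Real.le_sqrt_of_sq_le (by nlinarith [sq_nonneg ‖p.snd‖])

theorem norm_le_norm_fst_add_norm_snd {E : Type*} [NormedAddCommGroup E]
    (p : WithLp 2 (E × ℝ)) : ‖p‖ ≤ ‖p.fst‖ + ‖p.snd‖ := by
  rw [WithLp.prod_norm_eq_of_L2]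
  refine Real.sqrt_le_iff.2 ⟨by positivity, ?_⟩
  nlinarith [norm_nonneg p.fst, norm_nonneg p.snd]

theorem smul_mem_regularNormalCone {S : Set E} {x v : E} (hv : v ∈ regularNormalCone S x)
    {τ : ℝ} (hτ : 0 < τ) : τ • v ∈ regularNormalCone S x := by
  refine ⟨hv.1, fun ε hε => ?_⟩
  filter_upwards [hv.2 (ε / τ) (by positivity)] with z hz
  rw [real_inner_smul_left]
  calc τ * inner ℝ v (z - x) ≤ τ * (ε / τ * ‖z - x‖) := by gcongr
    _ = ε * ‖z - x‖ := by field_simp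

theorem add_mem_regularNormalCone {S : Set E} {x v w : E} (hv : v ∈ regularNormalCone S x)
    (hw : w ∈ regularNormalCone S x) : v + w ∈ regularNormalCone S x := by
  refine ⟨hv.1, fun ε hε => ?_⟩
  filter_upwards [hv.2 (ε / 2) (by positivity), hw.2 (ε / 2) (by positivity)] with z hz hz'
  rw [inner_add_left]
  linarith

theorem mem_regularNormalCone_epigraph {h : E → EReal} {x v : E}
    (hv : v ∈ regularSubdifferential h x) :
    (WithLp.toLp 2 (v, (-1 : ℝ))) ∈
      regularNormalCone (epigraph h) (WithLp.toLp 2 (x, (h x).toReal)) := by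
  obtain ⟨a, ha⟩ := hv.1.exists_real
  refine ⟨by simp [epigraph, ha], fun ε hε => ?_⟩
  have hfst : Tendsto (fun p : WithLp 2 (E × ℝ) => p.fst)
      (𝓝[epigraph h] (WithLp.toLp 2 (x, (h x).toReal))) (𝓝 x) := by
    have : Continuous (fun p : WithLp 2 (E × ℝ) => p.fst) := by fun_prop
    exact (this.tendsto (WithLp.toLp 2 (x, (h x).toReal))).mono_left nhdsWithin_le_nhds
  filter_upwards [hfst.eventually (hv.2 ε hε), self_mem_nhdsWithin] with p hp hpe
  have h1 := hp.trans (show h p.fst ≤ (p.snd : EReal) from hpe)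
  rw [ha] at h1
  norm_cast at h1
  rw [WithLp.prod_inner_apply]
  have h2 := norm_fst_le_norm (p - WithLp.toLp 2 (x, (h x).toReal))
  simp only [WithLp.sub_fst, WithLp.toLp_fst] at h2
  have h3 : ε * ‖p.fst - x‖ ≤ ε * ‖p - WithLp.toLp 2 (x, (h x).toReal)‖ := by gcongr
  have e1 : (p - WithLp.toLp 2 (x, (h x).toReal)).ofLp.1 = p.fst - x := rfl
  have e2 : (p - WithLp.toLp 2 (x, (h x).toReal)).ofLp.2 = p.snd - a := by
    rw [ha]; rfl
  rw [e1, e2]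
  simp only [RCLike.inner_apply, conj_trivial]
  linarith

/-- If the subgradient inequality failed at z, the point of height h x + ⟪v, z - x⟫ - ε‖z - x‖ above
z would lie in the epigraph. Its pairing with (v, -1), relative to the base point, is ε‖z - x‖, too
large for a regular normal. -/
theorem mem_regularSubdifferential_of_epigraph {h : E → EReal} {x v : E} (hx : FiniteAt h x)
    (hv : (WithLp.toLp 2 (v, (-1 : ℝ))) ∈
      regularNormalCone (epigraph h) (WithLp.toLp 2 (x, (h x).toReal))) :
    v ∈ regularSubdifferential h x := by
  obtain ⟨a, ha⟩ := hx.exists_real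
  refine ⟨hx, fun ε hε => ?_⟩
  -- B‖z - x‖ bounds the distance from the test point to the base point; tolerance ε/(2B) thus
  -- leaves ε/2 < ε.
  set B : ℝ := 1 + ‖v‖ + ε with hB
  have hBpos : 0 < B := by positivity
  have h1 := hv.2 (ε / (2 * B)) (by positivity)
  rw [eventually_nhdsWithin_iff] at h1
  have hlim : Tendsto (fun z : E => WithLp.toLp 2 (z, a + (inner ℝ v (z - x) - ε * ‖z - x‖)))
      (𝓝 x) (𝓝 (WithLp.toLp 2 (x, (h x).toReal))) := by
    have : Continuous (fun z : E => WithLp.toLp 2 (z, a + (inner ℝ v (z - x) - ε * ‖z - x‖))) := by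
      fun_prop
    have := this.tendsto x
    simpa [ha] using this
  filter_upwards [hlim.eventually h1] with z hz
  by_contra! hlt
  rw [ha] at hlt
  have hmem : WithLp.toLp 2 (z, a + (inner ℝ v (z - x) - ε * ‖z - x‖)) ∈ epigraph h := by
    simp only [epigraph, Set.mem_ofPred_eq, WithLp.toLp_fst, WithLp.toLp_snd]
    exact_mod_cast hlt.le
  have h2 := hz hmem
  have hzx : 0 < ‖z - x‖ := by
    rw [norm_pos_iff, sub_ne_zero]
    rintro rfl
    simp [ha] at hlt
  rw [WithLp.prod_inner_apply] at h2
  have h3 := norm_le_norm_fst_add_norm_snd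
    (WithLp.toLp 2 (z, a + (inner ℝ v (z - x) - ε * ‖z - x‖)) - WithLp.toLp 2 (x, (h x).toReal))
  simp only [WithLp.sub_fst, WithLp.sub_snd, WithLp.toLp_fst, WithLp.toLp_snd, ha,
    EReal.toReal_coe, add_sub_cancel_left] at h3
  have h4 : ‖(inner ℝ v (z - x) - ε * ‖z - x‖ : ℝ)‖ ≤ (‖v‖ + ε) * ‖z - x‖ := by
    refine (norm_sub_le _ _).trans ?_
    have := norm_inner_le_norm (𝕜 := ℝ) v (z - x)
    rw [norm_mul, norm_norm, Real.norm_of_nonneg hε.le]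
    linarith
  simp only [ha, EReal.toReal_coe, WithLp.ofLp_sub, Prod.fst_sub, Prod.snd_sub,
    add_sub_cancel_left, RCLike.inner_apply, conj_trivial] at h2
  have h5 : ‖WithLp.toLp 2 (z, a + (inner ℝ v (z - x) - ε * ‖z - x‖)) - WithLp.toLp 2 (x, a)‖
      ≤ B * ‖z - x‖ := by rw [hB]; linarith
  have h6 := mul_le_mul_of_nonneg_left h5 (show 0 ≤ ε / (2 * B) by positivity)
  have h7 : ε / (2 * B) * (B * ‖z - x‖) = ε / 2 * ‖z - x‖ := by field_simp
  have h8 : 0 < ε * ‖z - x‖ := by positivity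
  linarith

/-- For a subdifferentially regular function, limits `w = lim τ k • v k`, `τ k ↓ 0`, of rescaled
regular subgradients are recession directions of the subdifferential. -/
theorem add_mem_subdifferential_of_horizon {h : E → EReal} {x vbar w : E}
    (hreg : SubdifferentiallyRegularAt h x) (hvbar : vbar ∈ subdifferential h x)
    {y v : ℕ → E} {τ : ℕ → ℝ} (hy : Tendsto y atTop (𝓝 x))
    (hhy : Tendsto (fun k => h (y k)) atTop (𝓝 (h x)))
    (hv : ∀ k, v k ∈ regularSubdifferential h (y k)) (hτ : ∀ k, 0 < τ k)
    (hτ0 : Tendsto τ atTop (𝓝 0)) (hw : Tendsto (fun k => τ k • v k) atTop (𝓝 w)) :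
    vbar + w ∈ subdifferential h x := by
  obtain ⟨hfin, hmem, -, hcr⟩ := hreg
  have hpt : ∀ u : ℕ → E, Tendsto u atTop (𝓝 x) →
      Tendsto (fun k => h (u k)) atTop (𝓝 (h x)) →
      Tendsto (fun k => WithLp.toLp 2 (u k, (h (u k)).toReal)) atTop
        (𝓝 (WithLp.toLp 2 (x, (h x).toReal))) := fun u hu hhu => by
    have : Continuous (fun p : E × ℝ => WithLp.toLp 2 p) := by fun_prop
    exact (this.tendsto _).comp (hu.prodMk_nhds ((EReal.tendsto_toReal hfin.1 hfin.2).comp hhu))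
  have hvec : ∀ (u : ℕ → E) (s : ℕ → ℝ) (u' : E) (s' : ℝ), Tendsto u atTop (𝓝 u') →
      Tendsto s atTop (𝓝 s') →
      Tendsto (fun k => WithLp.toLp 2 (u k, s k)) atTop (𝓝 (WithLp.toLp 2 (u', s'))) :=
    fun u s u' s' hu hs => by
    have : Continuous (fun p : E × ℝ => WithLp.toLp 2 p) := by fun_prop
    exact (this.tendsto _).comp (hu.prodMk_nhds hs)
  have hA : WithLp.toLp 2 (vbar, (-1 : ℝ)) ∈
      regularNormalCone (epigraph h) (WithLp.toLp 2 (x, (h x).toReal)) := by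
    rw [← hcr]
    obtain ⟨-, u, ω, hu, hhu, hω, hωv⟩ := hvbar
    exact ⟨hmem, _, fun k => WithLp.toLp 2 (ω k, (-1 : ℝ)), hpt u hu hhu,
      fun k => mem_regularNormalCone_epigraph (hω k), hvec _ _ _ _ hωv tendsto_const_nhds⟩
  -- The scaled normals τ(v, -1) tend to (w, 0). Clarke regularity makes this limit a regular
  -- normal, and regular normals can be added to give (vbar + w, -1).
  have hB : WithLp.toLp 2 (w, (0 : ℝ)) ∈
      regularNormalCone (epigraph h) (WithLp.toLp 2 (x, (h x).toReal)) := by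
    rw [← hcr]
    refine ⟨hmem, _, fun k => τ k • WithLp.toLp 2 (v k, (-1 : ℝ)), hpt y hy hhy,
      fun k => smul_mem_regularNormalCone (mem_regularNormalCone_epigraph (hv k)) (hτ k), ?_⟩
    have := hvec (fun k => τ k • v k) (fun k => τ k * (-1)) w 0 hw (by simpa using hτ0.neg)
    exact this
  refine regularSubdifferential_subset_subdifferential h x
    (mem_regularSubdifferential_of_epigraph hfin ?_)
  have := add_mem_regularNormalCone hA hB
  have e : WithLp.toLp 2 (vbar, (-1 : ℝ)) + WithLp.toLp 2 (w, (0 : ℝ))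
      = WithLp.toLp 2 (vbar + w, (-1 : ℝ)) := by
    rw [← WithLp.toLp_add]; simp
  rwa [e] at this

end Epigraph

/-! ### Extended-real arithmetic and semicontinuity -/

theorem coe_le_add_coe_iff (a r : ℝ) (x : EReal) :
    (a : EReal) ≤ x + (r : EReal) ↔ ((a - r : ℝ) : EReal) ≤ x := by
  rw [EReal.coe_sub, EReal.sub_le_iff_le_add (by simp) (by simp)]

theorem lowerSemicontinuousAt_add_coe {α : Type*} [TopologicalSpace α] {f : α → EReal}
    {r : α → ℝ} {x : α} (hf : LowerSemicontinuousAt f x) (hr : ContinuousAt r x) :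
    LowerSemicontinuousAt (fun z => f z + ((r z : ℝ) : EReal)) x :=
  hf.add' ((continuous_coe_real_ereal.continuousAt.comp hr).lowerSemicontinuousAt)
    (EReal.continuousAt_add (by simp) (by simp))

/-- A lower semicontinuous function that avoids `⊥` on a compact set is bounded below there. -/
theorem exists_real_lower_bound {α : Type*} [TopologicalSpace α] {f : α → EReal} {K : Set α}
    (hK : IsCompact K) (hf : LowerSemicontinuousOn f K) (hbot : ∀ z ∈ K, f z ≠ ⊥) :
    ∃ B : ℝ, ∀ z ∈ K, (B : EReal) ≤ f z := by
  rcases K.eq_empty_or_nonempty with rfl | hne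
  · exact ⟨0, by simp⟩
  obtain ⟨z₀, hz₀, hmin⟩ := hf.exists_isMinOn hne hK
  by_cases htop : f z₀ = ⊤
  · exact ⟨0, fun z hz => by
      have : f z₀ ≤ f z := hmin hz
      rw [htop, top_le_iff] at this
      simp [this]⟩
  · obtain ⟨B, hB⟩ := FiniteAt.exists_real ⟨htop, hbot z₀ hz₀⟩
    exact ⟨B, fun z hz => by rw [← hB]; exact hmin hz⟩

theorem finiteAt_of_add_coe {α : Type*} {H : α → EReal} {r : α → ℝ} {x : α}
    (h : FiniteAt (fun z => H z + ((r z : ℝ) : EReal)) x) : FiniteAt H x :=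
  ⟨fun e => h.1 (by simp only [e]; exact EReal.top_add_coe _),
    fun e => h.2 (by simp only [e]; exact EReal.bot_add _)⟩

/-! ### Fuzzy chain rule by penalization -/

section FuzzyCalculus

variable {X Y : Type*} [NormedAddCommGroup X] [InnerProductSpace ℝ X]
  [NormedAddCommGroup Y] [InnerProductSpace ℝ Y]

/-- A regular subgradient of `H + (μ/2)‖·‖²` gives one of `H`. -/
theorem sub_smul_mem_regularSubdifferential {H : X → EReal} {μ : ℝ} {u w : X}
    (hw : w ∈ regularSubdifferential (fun d => H d + ((μ / 2 * ‖d‖ ^ 2 : ℝ) : EReal)) u) :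
    w - μ • u ∈ regularSubdifferential H u := by
  obtain ⟨hfin', hw⟩ := hw
  have hfin : FiniteAt H u := finiteAt_of_add_coe hfin'
  obtain ⟨a, ha⟩ := hfin.exists_real
  refine ⟨hfin, fun ε hε => ?_⟩
  have hball : ∀ᶠ z in 𝓝 u, ‖z - u‖ < ε / (|μ| + 1) := by
    filter_upwards [Metric.ball_mem_nhds u (show 0 < ε / (|μ| + 1) by positivity)] with z hz
    rwa [Metric.mem_ball, dist_eq_norm] at hz
  filter_upwards [hw (ε / 2) (by positivity), hball] with z hz hz'
  simp only [ha] at hz ⊢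
  norm_cast at hz ⊢
  rw [coe_le_add_coe_iff] at hz
  refine le_trans ?_ hz
  norm_cast
  have e : ‖z‖ ^ 2 = ‖u‖ ^ 2 + 2 * inner ℝ u (z - u) + ‖z - u‖ ^ 2 := by
    rw [← norm_add_sq_real]; simp
  rw [e, inner_sub_left, inner_smul_left]
  have h1 : (|μ| + 1) * ‖z - u‖ ≤ ε := by
    rw [lt_div_iff₀ (by positivity)] at hz'; linarith
  have h2 : μ * ‖z - u‖ ^ 2 ≤ ε * ‖z - u‖ := by
    have := mul_le_mul_of_nonneg_right h1 (norm_nonneg (z - u))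
    nlinarith [le_abs_self μ, sq_nonneg ‖z - u‖]
  simp only [conj_trivial]
  linarith

/-- A proximal-type minimality condition yields a regular subgradient. -/
theorem smul_mem_regularSubdifferential_of_isMin {h : Y → EReal} {j : ℝ} (hj : 0 < j) {y z₀ : Y}
    (hfin : FiniteAt h y)
    (hmin : ∀ᶠ z in 𝓝 y, h y + ((j * ‖y - z₀‖ ^ 2 : ℝ) : EReal) ≤
      h z + ((j * ‖z - z₀‖ ^ 2 : ℝ) : EReal)) :
    (-(2 * j)) • (y - z₀) ∈ regularSubdifferential h y := by
  obtain ⟨a, ha⟩ := hfin.exists_real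
  refine ⟨hfin, fun ε hε => ?_⟩
  have hball : ∀ᶠ z in 𝓝 y, ‖z - y‖ < ε / j := by
    filter_upwards [Metric.ball_mem_nhds y (show 0 < ε / j by positivity)] with z hz
    rwa [Metric.mem_ball, dist_eq_norm] at hz
  filter_upwards [hmin, hball] with z hz hz'
  rw [ha] at hz ⊢
  norm_cast at hz ⊢
  rw [coe_le_add_coe_iff] at hz
  refine le_trans ?_ hz
  norm_cast
  have e : ‖z - z₀‖ ^ 2 = ‖y - z₀‖ ^ 2 + 2 * inner ℝ (y - z₀) (z - y) + ‖z - y‖ ^ 2 := by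
    rw [← norm_add_sq_real]; simp
  rw [e, inner_smul_left]
  have h1 : j * ‖z - y‖ ≤ ε := by
    rw [lt_div_iff₀ hj] at hz'; linarith
  have h2 := mul_le_mul_of_nonneg_right h1 (norm_nonneg (z - y))
  simp only [conj_trivial]
  nlinarith

/-- If `t ‖g‖² ≤ ε t ‖g‖ + O(t²)` as `t ↓ 0`, then `‖g‖ ≤ ε`. -/
theorem norm_le_of_eventually_descent {X : Type*} [NormedAddCommGroup X] {g : X} {ε C : ℝ}
    (h : ∀ᶠ t : ℝ in 𝓝[>] 0, t * ‖g‖ ^ 2 ≤ ε * (t * ‖g‖) + C * t ^ 2) : ‖g‖ ≤ ε ∨ g = 0 := by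
  by_cases hg : g = 0
  · exact Or.inr hg
  left
  have hpos : 0 < ‖g‖ := norm_pos_iff.2 hg
  have hlim : Tendsto (fun t : ℝ => ε * ‖g‖ + C * t) (𝓝[>] 0) (𝓝 (ε * ‖g‖)) := by
    have : Continuous fun t : ℝ => ε * ‖g‖ + C * t := by fun_prop
    simpa using (this.tendsto 0).mono_left nhdsWithin_le_nhds
  have : ‖g‖ ^ 2 ≤ ε * ‖g‖ := by
    refine ge_of_tendsto hlim ?_
    filter_upwards [h, self_mem_nhdsWithin] with t ht ht0
    have ht0 : 0 < t := ht0
    exact le_of_mul_le_mul_left (by linarith) ht0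
  nlinarith

variable [FiniteDimensional ℝ X] [FiniteDimensional ℝ Y]

/-- Fuzzy chain rule: a regular subgradient of `d ↦ h (p + L d)` is approximated by images under
the adjoint of `L` of regular subgradients of `h` at nearby points. -/
theorem exists_regular_subgradient_comp_affine {h : Y → EReal} {p : Y} {L : X →L[ℝ] Y} {u q : X}
    {r : ℝ} (hr : 0 < r) (hlsc : ∀ z, ‖z - (p + L u)‖ < r → LowerSemicontinuousAt h z)
    (hbot : ∀ z, ‖z - (p + L u)‖ < r → h z ≠ ⊥)
    (hq : q ∈ regularSubdifferential (fun d => h (p + L d)) u)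
    {η : ℝ} (hη : 0 < η) {U : Set EReal} (hU : U ∈ 𝓝 (h (p + L u))) :
    ∃ y v, ‖y - (p + L u)‖ < η ∧ h y ∈ U ∧ v ∈ regularSubdifferential h y ∧
      ‖ContinuousLinearMap.adjoint L v - q‖ < η := by
  set y₀ := p + L u with hy₀
  obtain ⟨a, ha⟩ : ∃ a : ℝ, h y₀ = a := FiniteAt.exists_real hq.1
  set ε := η / 4 with hεdef
  have hε : 0 < ε := by positivity
  obtain ⟨R₁, hR₁, hsub⟩ := Metric.eventually_nhds_iff.1 (hq.2 ε hε)
  set R := min (r / 2) (R₁ / 2)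
  have hR : 0 < R := by positivity
  have hRr : R < r := (min_le_left _ _).trans_lt (by linarith)
  have hRR₁ : R < R₁ := (min_le_right _ _).trans_lt (by linarith)
  set K : Set (X × Y) := Metric.closedBall u R ×ˢ Metric.closedBall y₀ R with hKdef
  have hKc : IsCompact K := (isCompact_closedBall u R).prod (isCompact_closedBall y₀ R)
  have hmemK : ∀ q : X × Y, q ∈ K ↔ ‖q.1 - u‖ ≤ R ∧ ‖q.2 - y₀‖ ≤ R := fun q => by
    simp [hKdef, dist_eq_norm]
  have hK0 : (u, y₀) ∈ K := by rw [hmemK]; simp [hR.le]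
  obtain ⟨B, hB⟩ := exists_real_lower_bound (f := h) (isCompact_closedBall y₀ R)
    (fun z hz => (hlsc z (by
      rw [Metric.mem_closedBall, dist_eq_norm] at hz; linarith)).lowerSemicontinuousWithinAt _)
    (fun z hz => hbot z (by rw [Metric.mem_closedBall, dist_eq_norm] at hz; linarith))
  have hB' : ∀ z, ‖z - y₀‖ ≤ R → (B : EReal) ≤ h z := fun z hz =>
    hB z (by rwa [Metric.mem_closedBall, dist_eq_norm])
  -- The constraint y = p + L d is decoupled by a quadratic penalty of weight j + 1. The slack 2ε
  -- exceeds the ε in the subgradient inequality on `K`, so that minimizers are forced towards u.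
  set θ : ℕ → X × Y → ℝ := fun j x =>
    -inner ℝ q (x.1 - u) + 2 * ε * ‖x.1 - u‖ + ((j : ℝ) + 1) * ‖x.2 - (p + L x.1)‖ ^ 2 with hθ
  have hθc : ∀ j, Continuous (θ j) := fun j => by simp only [hθ]; fun_prop
  have hex : ∀ j : ℕ, ∃ x ∈ K, IsMinOn (fun x : X × Y => h x.2 + ((θ j x : ℝ) : EReal)) K x :=
    fun j => LowerSemicontinuousOn.exists_isMinOn ⟨_, hK0⟩ hKc fun x hx =>
      LowerSemicontinuousAt.lowerSemicontinuousWithinAt _ (lowerSemicontinuousAt_add_coe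
        ((hlsc x.2 (by have := ((hmemK x).1 hx).2; linarith)).comp continuous_snd.continuousAt)
        (hθc j).continuousAt)
  choose x hxK hxmin using hex
  have hval : ∀ j, h (x j).2 + ((θ j (x j) : ℝ) : EReal) ≤ (a : EReal) := fun j => by
    have h1 : _ ≤ h (u, y₀).2 + ((θ j (u, y₀) : ℝ) : EReal) := hxmin j hK0
    have h2 : θ j (u, y₀) = 0 := by simp [hθ, hy₀]
    rwa [h2, ha, EReal.coe_zero, add_zero] at h1
  have hfinx : ∀ j, FiniteAt h (x j).2 := fun j => by
    have h1 := hB' _ ((hmemK _).1 (hxK j)).2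
    have h2 := hval j
    rw [add_coe_le_coe_iff] at h2
    exact ⟨ne_top_of_le_ne_top (EReal.coe_ne_top _) h2, ne_bot_of_le_ne_bot (EReal.coe_ne_bot _) h1⟩
  choose b hb using fun j => (hfinx j).exists_real
  have hbB : ∀ j, B ≤ b j := fun j => by
    have := hB' _ ((hmemK _).1 (hxK j)).2
    rw [hb] at this; exact_mod_cast this
  have hbval : ∀ j, b j + θ j (x j) ≤ a := fun j => by
    have := hval j
    rw [hb] at this; exact_mod_cast this
  obtain ⟨xs, hxs, φ, hφ, hlim⟩ := hKc.tendsto_subseq hxK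
  have hlim1 : Tendsto (fun k => (x (φ k)).1) atTop (𝓝 xs.1) :=
    (continuous_fst.tendsto _).comp hlim
  have hlim2 : Tendsto (fun k => (x (φ k)).2) atTop (𝓝 xs.2) :=
    (continuous_snd.tendsto _).comp hlim
  have hpen : Tendsto (fun k => ‖(x (φ k)).2 - (p + L (x (φ k)).1)‖ ^ 2) atTop (𝓝 0) := by
    -- Comparison with (u, y₀), where θ vanishes, and the lower bound `B` on h bound the weighted
    -- penalty by `C`; hence the squared mismatch is O(1/(j + 1)).
    set C := a - B + ‖q‖ * R
    have hle : ∀ j : ℕ, ((j : ℝ) + 1) * ‖(x j).2 - (p + L (x j).1)‖ ^ 2 ≤ C := fun j => by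
      have h1 := hbval j
      have h2 := hbB j
      have h3 := real_inner_le_norm q ((x j).1 - u)
      have h4 := mul_le_mul_of_nonneg_left ((hmemK _).1 (hxK j)).1 (norm_nonneg q)
      have h5 : 0 ≤ 2 * ε * ‖(x j).1 - u‖ := by positivity
      simp only [hθ] at h1
      simp only [C]
      linarith
    have h0 : Tendsto (fun j : ℕ => ‖(x j).2 - (p + L (x j).1)‖ ^ 2) atTop (𝓝 0) := by
      refine squeeze_zero (fun j => by positivity) (g := fun j : ℕ => C * (1 / ((j : ℝ) + 1)))
        (fun j => ?_) ?_
      · rw [mul_one_div, le_div_iff₀ (by positivity)]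
        linarith [hle j]
      · simpa using (tendsto_one_div_add_atTop_nhds_zero_nat (𝕜 := ℝ)).const_mul C
    exact h0.comp hφ.tendsto_atTop
  have hxs2 : xs.2 = p + L xs.1 := by
    have h1 : Tendsto (fun k => ‖(x (φ k)).2 - (p + L (x (φ k)).1)‖ ^ 2) atTop
        (𝓝 (‖xs.2 - (p + L xs.1)‖ ^ 2)) :=
      ((hlim2.sub (((L.continuous.tendsto _).comp hlim1).const_add p)).norm).pow 2
    have := tendsto_nhds_unique h1 hpen
    rwa [sq_eq_zero_iff, norm_eq_zero, sub_eq_zero] at this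
  have hbup : ∀ j, b j ≤ a + inner ℝ q ((x j).1 - u) - 2 * ε * ‖(x j).1 - u‖ := fun j => by
    have h1 := hbval j
    have h2 : 0 ≤ ((j : ℝ) + 1) * ‖(x j).2 - (p + L (x j).1)‖ ^ 2 := by positivity
    simp only [hθ] at h1
    linarith
  have hlscs := hlsc xs.2 (by have := ((hmemK xs).1 hxs).2; linarith)
  -- At the limit, the subgradient inequality bounds h below with slack ε, while minimality and
  -- lower semicontinuity bound it above with slack 2ε. Both hold only at u.
  have hxs1 : xs.1 = u := by
    have h1 : h (p + L u) + ((inner ℝ q (xs.1 - u) - ε * ‖xs.1 - u‖ : ℝ) : EReal) ≤ h xs.2 := by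
      have := hsub (y := xs.1) (by
        rw [dist_eq_norm]; exact ((hmemK xs).1 hxs).1.trans_lt hRR₁)
      simpa only [← hxs2] using this
    have h2 : h xs.2 ≤ ((a + inner ℝ q (xs.1 - u) - 2 * ε * ‖xs.1 - u‖ : ℝ) : EReal) := by
      by_contra! hlt
      obtain ⟨s, hs1, hs2⟩ := EReal.lt_iff_exists_real_btwn.1 hlt
      have h3 := hlim2.eventually (hlscs s hs2)
      have h4 : Tendsto (fun k => a + inner ℝ q ((x (φ k)).1 - u) - 2 * ε * ‖(x (φ k)).1 - u‖)
          atTop (𝓝 (a + inner ℝ q (xs.1 - u) - 2 * ε * ‖xs.1 - u‖)) := by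
        have : Continuous fun d : X => a + inner ℝ q (d - u) - 2 * ε * ‖d - u‖ := by fun_prop
        exact (this.tendsto _).comp hlim1
      obtain ⟨k, hk1, hk2⟩ := (h3.and (h4.eventually_lt_const (EReal.coe_lt_coe_iff.1 hs1))).exists
      rw [hb] at hk1
      have := hbup (φ k)
      have hk1 := EReal.coe_lt_coe_iff.1 hk1
      linarith
    have h3 := h1.trans h2
    rw [← hy₀, ha] at h3
    norm_cast at h3
    have : ε * ‖xs.1 - u‖ ≤ 0 := by linarith
    have : ‖xs.1 - u‖ ≤ 0 := by
      by_contra! hc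
      have := mul_pos hε hc
      linarith
    exact sub_eq_zero.1 (norm_le_zero_iff.1 this)
  rw [hxs1, ← hy₀] at hxs2
  rw [hxs1] at hlim1
  rw [hxs2] at hlim2 hlscs
  have hblim : Tendsto (fun k => h (x (φ k)).2) atTop (𝓝 (h y₀)) := by
    refine tendsto_order.2 ⟨fun s hs => hlim2.eventually (hlscs s hs), fun s hs => ?_⟩
    have h4 : Tendsto (fun k => ((a + inner ℝ q ((x (φ k)).1 - u) - 2 * ε * ‖(x (φ k)).1 - u‖ : ℝ)
        : EReal)) atTop (𝓝 (a : EReal)) := by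
      have : Continuous fun d : X =>
          ((a + inner ℝ q (d - u) - 2 * ε * ‖d - u‖ : ℝ) : EReal) :=
        continuous_coe_real_ereal.comp (by fun_prop)
      have := (this.tendsto _).comp hlim1
      simpa only [Function.comp_def, sub_self, inner_zero_right, norm_zero, mul_zero, add_zero,
        sub_zero] using this
    rw [ha] at hs
    filter_upwards [h4.eventually_lt_const hs] with k hk
    refine lt_of_le_of_lt ?_ hk
    rw [hb]
    exact_mod_cast hbup (φ k)
  have e1 := (tendsto_iff_norm_sub_tendsto_zero.1 hlim1).eventually_lt_const hR
  have e2 := (tendsto_iff_norm_sub_tendsto_zero.1 hlim2).eventually_lt_const (lt_min hR hη)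
  obtain ⟨k, hk1, hk2, hk3⟩ := (e1.and (e2.and (hblim.eventually_mem hU))).exists
  set j := φ k
  set d := (x j).1 with hd
  set y := (x j).2 with hy
  have hjpos : (0 : ℝ) < (j : ℝ) + 1 := by positivity
  have hmin : ∀ d' y', ‖d' - u‖ ≤ R → ‖y' - y₀‖ ≤ R →
      h y + ((θ j (d, y) : ℝ) : EReal) ≤ h y' + ((θ j (d', y') : ℝ) : EReal) :=
    fun d' y' h1 h2 => hxmin j ((hmemK (d', y')).2 ⟨h1, h2⟩)
  -- Minus the y-gradient of the penalty: minimality in y makes it a regular subgradient of h, and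
  -- minimality in d will make L*v almost equal to q.
  set v := (-(2 * ((j : ℝ) + 1))) • (y - (p + L d)) with hv
  refine ⟨y, v, hk2.trans_le (min_le_right _ _), hk3, ?_, ?_⟩
  · refine smul_mem_regularSubdifferential_of_isMin hjpos (hfinx j) ?_
    have hnear : ∀ᶠ z in 𝓝 y, ‖z - y₀‖ < R := by
      have : ContinuousAt (fun z : Y => ‖z - y₀‖) y := by fun_prop
      exact this.eventually_lt_const (hk2.trans_le (min_le_left _ _))
    filter_upwards [hnear] with z hz
    have h1 := hmin d z hk1.le hz.le
    rw [hb j] at h1 ⊢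
    norm_cast at h1 ⊢
    rw [coe_le_add_coe_iff] at h1 ⊢
    refine le_trans ?_ h1
    rw [EReal.coe_le_coe_iff]
    simp only [hθ]
    push_cast
    linarith
  · set g := ContinuousLinearMap.adjoint L v - q with hg
    -- The minimum is tested along d - t g with y fixed. To first order the objective changes by
    -- -t‖g‖² plus at most 2εt‖g‖, so ‖g‖ ≤ 2ε = η/2.
    have hdesc : ∀ᶠ t : ℝ in 𝓝[>] 0, t * ‖g‖ ^ 2 ≤
        (2 * ε) * (t * ‖g‖) + (((j : ℝ) + 1) * ‖L g‖ ^ 2) * t ^ 2 := by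
      have hnear : ∀ᶠ t : ℝ in 𝓝[>] 0, ‖d - t • g - u‖ < R := by
        have : Continuous (fun t : ℝ => ‖d - t • g - u‖) := by fun_prop
        exact nhdsWithin_le_nhds ((this.tendsto 0).eventually_lt_const (by simpa using hk1))
      filter_upwards [hnear, self_mem_nhdsWithin] with t ht ht0
      have ht0 : 0 < t := ht0
      have h1 := hmin (d - t • g) y ht.le (hk2.trans_le (min_le_left _ _)).le
      rw [hb j] at h1
      norm_cast at h1
      simp only [hθ] at h1
      have e3 : ‖d - t • g - u‖ ≤ ‖d - u‖ + t * ‖g‖ := by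
        have : d - t • g - u = (d - u) - t • g := by abel
        rw [this]
        refine (norm_sub_le _ _).trans ?_
        rw [norm_smul, Real.norm_of_nonneg ht0.le]
      have e4 : ‖y - (p + L (d - t • g))‖ ^ 2 = ‖y - (p + L d)‖ ^ 2
          + 2 * (t * inner ℝ (y - (p + L d)) (L g)) + t ^ 2 * ‖L g‖ ^ 2 := by
        have : y - (p + L (d - t • g)) = (y - (p + L d)) + t • L g := by
          rw [map_sub, map_smul]; abel
        rw [this, norm_add_sq_real, inner_smul_right, norm_smul, mul_pow, Real.norm_eq_abs, sq_abs]
      have e5 : inner ℝ q (d - t • g - u) = inner ℝ q (d - u) - t * inner ℝ q g := by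
        have : d - t • g - u = (d - u) - t • g := by abel
        rw [this, inner_sub_right, inner_smul_right]
      have e6 : ‖g‖ ^ 2 = -(2 * ((j : ℝ) + 1)) * inner ℝ (y - (p + L d)) (L g) - inner ℝ q g := by
        rw [← real_inner_self_eq_norm_sq]
        nth_rewrite 1 [hg]
        rw [inner_sub_left, ContinuousLinearMap.adjoint_inner_left, hv, inner_smul_left]
        simp
      rw [e4, e5] at h1
      rw [e6]
      have e7 := mul_le_mul_of_nonneg_left e3 hε.le
      nlinarith
    rcases norm_le_of_eventually_descent hdesc with h1 | h1
    · linarith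
    · rw [h1, norm_zero]; exact hη

/-- Fuzzy stationarity condition for critical points of `d ↦ h (p + L d) + (μ/2)‖d‖²`. -/
theorem exists_regular_subgradient_of_critical {h : Y → EReal} {p : Y} {L : X →L[ℝ] Y}
    {μ : ℝ} {d : X} {r : ℝ} (hr : 0 < r)
    (hlsc : ∀ z, ‖z - (p + L d)‖ < r → LowerSemicontinuousAt h z)
    (hbot : ∀ z, ‖z - (p + L d)‖ < r → h z ≠ ⊥)
    (hd : (0 : X) ∈ subdifferential (fun d => h (p + L d) + ((μ / 2 * ‖d‖ ^ 2 : ℝ) : EReal)) d)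
    {η : ℝ} (hη : 0 < η) {U : Set EReal} (hU : U ∈ 𝓝 (h (p + L d))) :
    ∃ y v, ‖y - (p + L d)‖ < η ∧ h y ∈ U ∧ v ∈ regularSubdifferential h y ∧
      ‖ContinuousLinearMap.adjoint L v + μ • d‖ < η := by
  obtain ⟨-, u, w, hu, hfu, hw, hw0⟩ := hd
  have hhu : Tendsto (fun k => h (p + L (u k))) atTop (𝓝 (h (p + L d))) := by
    have h1 : Tendsto (fun k => ((-(μ / 2 * ‖u k‖ ^ 2) : ℝ) : EReal)) atTop
        (𝓝 ((-(μ / 2 * ‖d‖ ^ 2) : ℝ) : EReal)) :=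
      (continuous_coe_real_ereal.tendsto _).comp ((hu.norm.pow 2).const_mul _).neg
    have h2 := (EReal.continuousAt_add (p := (h (p + L d) + ((μ / 2 * ‖d‖ ^ 2 : ℝ) : EReal),
      ((-(μ / 2 * ‖d‖ ^ 2) : ℝ) : EReal))) (Or.inr (EReal.coe_ne_bot _))
      (Or.inr (EReal.coe_ne_top _))).tendsto.comp (hfu.prodMk_nhds h1)
    have e : ∀ (x : EReal) (s : ℝ), x + (s : EReal) + ((-s : ℝ) : EReal) = x := fun x s => by
      rw [add_assoc, ← EReal.coe_add, add_neg_cancel, EReal.coe_zero, add_zero]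
    simpa only [Function.comp_def, e] using h2
  have hpu : Tendsto (fun k => p + L (u k)) atTop (𝓝 (p + L d)) :=
    ((L.continuous.tendsto _).comp hu).const_add p
  have e1 := (tendsto_iff_norm_sub_tendsto_zero.1 hpu).eventually_lt_const
    (lt_min (half_pos hr) (half_pos hη))
  have hq : Tendsto (fun k => ‖(w k - μ • u k) + μ • d‖) atTop (𝓝 0) := by
    have := (((hw0.sub (hu.const_smul μ)).add_const (μ • d))).norm
    simpa using this
  have e2 := hq.eventually_lt_const (half_pos hη)
  have e3 := hhu.eventually (eventually_eventually_nhds.2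
    (show ∀ᶠ s in 𝓝 (h (p + L d)), s ∈ U from hU))
  obtain ⟨k, hk1, hk2, hk3⟩ := (e1.and (e2.and e3)).exists
  have hk1r := hk1.trans_le (min_le_left _ _)
  have hnear : ∀ z, ‖z - (p + L (u k))‖ < r / 2 → ‖z - (p + L d)‖ < r := fun z hz => by
    have := norm_sub_le_norm_sub_add_norm_sub z (p + L (u k)) (p + L d)
    linarith
  obtain ⟨y, v, hy, hyU, hv, hvq⟩ := exists_regular_subgradient_comp_affine (half_pos hr)
    (fun z hz => hlsc z (hnear z hz)) (fun z hz => hbot z (hnear z hz))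
    (sub_smul_mem_regularSubdifferential (hw k)) (half_pos hη) hk3
  refine ⟨y, v, ?_, hyU, hv, ?_⟩
  · have := norm_sub_le_norm_sub_add_norm_sub y (p + L (u k)) (p + L d)
    have := hk1.trans_le (min_le_right _ _)
    linarith
  · have e : ContinuousLinearMap.adjoint L v + μ • d = (ContinuousLinearMap.adjoint L v -
        (w k - μ • u k)) + ((w k - μ • u k) + μ • d) := by abel
    rw [e]
    have := norm_add_le (ContinuousLinearMap.adjoint L v - (w k - μ • u k))
      ((w k - μ • u k) + μ • d)
    linarith

end FuzzyCalculus

/-! ### Exact multipliers from the constraint qualification -/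

section Multipliers

variable {X Y : Type*} [NormedAddCommGroup X] [InnerProductSpace ℝ X] [FiniteDimensional ℝ X]
  [NormedAddCommGroup Y] [InnerProductSpace ℝ Y] [FiniteDimensional ℝ Y]

theorem tendsto_clm_apply {V W α : Type*} [NormedAddCommGroup V] [NormedSpace ℝ V]
    [NormedAddCommGroup W] [NormedSpace ℝ W] {l : Filter α} {T : α → V →L[ℝ] W} {T₀ : V →L[ℝ] W}
    {u : α → V} {u₀ : V} (hT : Tendsto T l (𝓝 T₀)) (hu : Tendsto u l (𝓝 u₀)) :
    Tendsto (fun a => T a (u a)) l (𝓝 (T₀ u₀)) :=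
  (isBoundedBilinearMap_apply.continuous.tendsto (T₀, u₀)).comp (hT.prodMk_nhds hu)

theorem eq_of_mem_subdifferential_of_adjoint_eq_zero {h : Y → EReal} {x v vbar : Y}
    {A : X →L[ℝ] Y} (hvbar : vbar ∈ subdifferential h x)
    (hA : ContinuousLinearMap.adjoint A vbar = 0)
    (hcq : (affineSpan ℝ (subdifferential h x)).direction ⊓
      LinearMap.ker (ContinuousLinearMap.adjoint A).toLinearMap = ⊥)
    (hv : v ∈ subdifferential h x) (hAv : ContinuousLinearMap.adjoint A v = 0) : v = vbar := by
  have : v - vbar ∈ (affineSpan ℝ (subdifferential h x)).direction ⊓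
      LinearMap.ker (ContinuousLinearMap.adjoint A).toLinearMap :=
    ⟨AffineSubspace.vsub_mem_direction (subset_affineSpan ℝ _ hv) (subset_affineSpan ℝ _ hvbar),
      by simp [hA, hAv]⟩
  rw [hcq, Submodule.mem_bot, sub_eq_zero] at this
  exact this

/-- Under the constraint qualification, nearly critical regular subgradients near the base point
are close to the critical subgradient `vbar`. -/
theorem eventually_norm_sub_lt_of_adjoint_small {h : Y → EReal} {x vbar : Y} {A : X →L[ℝ] Y}
    (hreg : SubdifferentiallyRegularAt h x) (hvbar : vbar ∈ subdifferential h x)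
    (hA : ContinuousLinearMap.adjoint A vbar = 0)
    (hcq : (affineSpan ℝ (subdifferential h x)).direction ⊓
      LinearMap.ker (ContinuousLinearMap.adjoint A).toLinearMap = ⊥)
    {ε : ℝ} (hε : 0 < ε) :
    ∀ᶠ q : (Y × EReal) × (X →L[ℝ] Y) × X in 𝓝 ((x, h x), (A, 0)),
      ∀ v ∈ regularSubdifferential h q.1.1, h q.1.1 = q.1.2 →
        ContinuousLinearMap.adjoint q.2.1 v = q.2.2 → ‖v - vbar‖ < ε := by
  -- The coordinate `q.1.2` stands for the value of h, so the neighbourhood filter encodes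
  -- convergence of points together with their values; h itself need not be continuous.
  by_contra hcon
  rw [not_eventually] at hcon
  obtain ⟨q, hq, hprop⟩ := exists_seq_forall_of_frequently hcon
  push Not at hprop
  choose v hv hhv hAv hvε using hprop
  have hy : Tendsto (fun k => (q k).1.1) atTop (𝓝 x) :=
    ((continuous_fst.comp continuous_fst).tendsto _).comp hq
  have hhy : Tendsto (fun k => h (q k).1.1) atTop (𝓝 (h x)) := by
    simp only [hhv]
    exact ((continuous_snd.comp continuous_fst).tendsto _).comp hq
  have hL : Tendsto (fun k => ContinuousLinearMap.adjoint (q k).2.1) atTop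
      (𝓝 (ContinuousLinearMap.adjoint A)) :=
    (ContinuousLinearMap.adjoint.continuous.tendsto _).comp
      (((continuous_fst.comp continuous_snd).tendsto _).comp hq)
  have hb : Tendsto (fun k => ContinuousLinearMap.adjoint (q k).2.1 (v k)) atTop (𝓝 0) := by
    simp only [hAv]
    exact ((continuous_snd.comp continuous_snd).tendsto _).comp hq
  -- A bounded subsequence clusters at a subgradient annihilated by A*, which must be vbar.
  by_cases hbdd : ∃ R : ℝ, ∃ᶠ k in atTop, ‖v k‖ ≤ R
  · obtain ⟨R, hR⟩ := hbdd
    obtain ⟨w, -, φ, hφ, hw⟩ := (isCompact_closedBall (0 : Y) R).tendsto_subseq'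
      (hR.mono fun k hk => by simpa using hk)
    have hwm : w ∈ subdifferential h x :=
      ⟨hreg.1, _, _, hy.comp hφ.tendsto_atTop, hhy.comp hφ.tendsto_atTop, fun k => hv (φ k), hw⟩
    have hAw : ContinuousLinearMap.adjoint A w = 0 :=
      tendsto_nhds_unique (tendsto_clm_apply (hL.comp hφ.tendsto_atTop) hw)
        (hb.comp hφ.tendsto_atTop)
    have := eq_of_mem_subdifferential_of_adjoint_eq_zero hvbar hA hcq hwm hAw
    subst this
    have h0 := tendsto_iff_norm_sub_tendsto_zero.1 hw
    obtain ⟨k, hk⟩ := (h0.eventually_lt_const hε).exists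
    exact absurd hk (not_lt.2 (hvε (φ k)))
  · push Not at hbdd
    have hinf : Tendsto (fun k => ‖v k‖) atTop atTop := by
      refine tendsto_atTop.2 fun R => ?_
      filter_upwards [hbdd R] with k hk using hk.le
    -- In the unbounded case the normalized subgradients yield a unit horizon direction w with A*w =
    -- 0. Then vbar + w is another critical subgradient, contradicting uniqueness. The +1 keeps
    -- every `τ k` finite and positive.
    set τ : ℕ → ℝ := fun k => (‖v k‖ + 1)⁻¹ with hτ
    have hτpos : ∀ k, 0 < τ k := fun k => by simp only [hτ]; positivity
    have hτ0 : Tendsto τ atTop (𝓝 0) :=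
      tendsto_inv_atTop_zero.comp (tendsto_atTop_add_const_right _ _ hinf)
    have hnorm : ∀ k, ‖τ k • v k‖ = 1 - τ k := fun k => by
      rw [norm_smul, Real.norm_of_nonneg (hτpos k).le]
      simp only [hτ]
      field_simp
      ring
    obtain ⟨w, -, φ, hφ, hw⟩ := (isCompact_closedBall (0 : Y) 1).tendsto_subseq
      (x := fun k => τ k • v k) (fun k => by
        rw [mem_closedBall_zero_iff, hnorm]; linarith [hτpos k])
    have hw1 : ‖w‖ = 1 := by
      refine tendsto_nhds_unique hw.norm ?_
      simp only [Function.comp_def, hnorm]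
      simpa using (hτ0.comp hφ.tendsto_atTop).const_sub 1
    have hwm : vbar + w ∈ subdifferential h x :=
      add_mem_subdifferential_of_horizon hreg hvbar (hy.comp hφ.tendsto_atTop)
        (hhy.comp hφ.tendsto_atTop) (fun k => hv (φ k)) (fun k => hτpos (φ k))
        (hτ0.comp hφ.tendsto_atTop) hw
    have hAw : ContinuousLinearMap.adjoint A w = 0 := by
      refine tendsto_nhds_unique (tendsto_clm_apply (hL.comp hφ.tendsto_atTop) hw) ?_
      have := (hτ0.smul hb).comp hφ.tendsto_atTop
      simpa [Function.comp_def] using this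
    have := eq_of_mem_subdifferential_of_adjoint_eq_zero hvbar hA hcq hwm (by simp [hA, hAw])
    rw [add_eq_left] at this
    simp [this] at hw1

/-- Exact multipliers for small critical points: they exist and are close to `vbar`. -/
theorem eventually_exists_multiplier {h : Y → EReal} {x vbar : Y} {A : X →L[ℝ] Y}
    (hreg : SubdifferentiallyRegularAt h x) (hvbar : vbar ∈ subdifferential h x)
    (hA : ContinuousLinearMap.adjoint A vbar = 0)
    (hcq : (affineSpan ℝ (subdifferential h x)).direction ⊓
      LinearMap.ker (ContinuousLinearMap.adjoint A).toLinearMap = ⊥)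
    (hlsc : ∀ᶠ z in 𝓝 x, LowerSemicontinuousAt h z) (hbot : ∀ᶠ z in 𝓝 x, h z ≠ ⊥)
    {ε : ℝ} (hε : 0 < ε) :
    ∀ᶠ q : (Y × EReal) × (X →L[ℝ] Y) × X in 𝓝 ((x, h x), (A, 0)),
      ∀ (p : Y) (μ : ℝ) (d : X), p + q.2.1 d = q.1.1 → h q.1.1 = q.1.2 → -(μ • d) = q.2.2 →
        (0 : X) ∈ subdifferential
          (fun d => h (p + q.2.1 d) + ((μ / 2 * ‖d‖ ^ 2 : ℝ) : EReal)) d →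
        ∃ v ∈ subdifferential h q.1.1,
          ContinuousLinearMap.adjoint q.2.1 v = -(μ • d) ∧ ‖v - vbar‖ ≤ ε := by
  have hnear : ∀ᶠ q : (Y × EReal) × (X →L[ℝ] Y) × X in 𝓝 ((x, h x), (A, 0)),
      ∀ᶠ z in 𝓝 q.1.1, LowerSemicontinuousAt h z ∧ h z ≠ ⊥ :=
    ((continuous_fst.comp continuous_fst).tendsto
      (((x, h x), (A, 0)) : (Y × EReal) × (X →L[ℝ] Y) × X)).eventually
      (eventually_eventually_nhds.2 (hlsc.and hbot))
  filter_upwards [hnear, eventually_eventually_nhds.2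
    (eventually_norm_sub_lt_of_adjoint_small hreg hvbar hA hcq hε)] with
    ⟨⟨y₀, s₀⟩, L, b₀⟩ hq1 hq2 p μ d hp hs hb hd
  simp only at hq1 hq2 hp hs hb hd ⊢
  subst hp hs hb
  obtain ⟨r, hr, hball⟩ := Metric.eventually_nhds_iff.1 hq1
  obtain ⟨U, hU⟩ := (𝓝 (h (p + L d))).exists_antitone_basis
  have hex : ∀ k : ℕ, ∃ y v, ‖y - (p + L d)‖ < 1 / ((k : ℝ) + 1) ∧ h y ∈ U k ∧
      v ∈ regularSubdifferential h y ∧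
      ‖ContinuousLinearMap.adjoint L v + μ • d‖ < 1 / ((k : ℝ) + 1) := fun k =>
    exists_regular_subgradient_of_critical hr
      (fun z hz => (hball (by rwa [dist_eq_norm])).1)
      (fun z hz => (hball (by rwa [dist_eq_norm])).2) hd (by positivity)
      (hU.1.mem_of_mem trivial)
  choose y v hy hyU hv hvb using hex
  have hzero := tendsto_one_div_add_atTop_nhds_zero_nat (𝕜 := ℝ)
  have hy' : Tendsto y atTop (𝓝 (p + L d)) :=
    tendsto_iff_norm_sub_tendsto_zero.2
      (squeeze_zero (fun _ => norm_nonneg _) (fun k => (hy k).le) hzero)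
  have hhy : Tendsto (fun k => h (y k)) atTop (𝓝 (h (p + L d))) := hU.tendsto hyU
  have hvb' : Tendsto (fun k => ContinuousLinearMap.adjoint L (v k)) atTop (𝓝 (-(μ • d))) :=
    tendsto_iff_norm_sub_tendsto_zero.2
      (squeeze_zero (fun _ => norm_nonneg _) (fun k => by
        rw [sub_neg_eq_add]; exact (hvb k).le) hzero)
  -- The approximate multipliers are close to vbar, hence bounded, and a cluster point is an exact
  -- multiplier.
  have hclose : ∀ᶠ k in atTop, ‖v k - vbar‖ < ε := by
    have hT : Tendsto (fun k => (((y k, h (y k)), (L, ContinuousLinearMap.adjoint L (v k))) :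
        (Y × EReal) × (X →L[ℝ] Y) × X)) atTop (𝓝 ((p + L d, h (p + L d)), (L, -(μ • d)))) :=
      (hy'.prodMk_nhds hhy).prodMk_nhds (tendsto_const_nhds.prodMk_nhds hvb')
    filter_upwards [hT.eventually hq2] with k hk using hk (v k) (hv k) rfl rfl
  obtain ⟨w, hwmem, φ, hφ, hw⟩ := (isCompact_closedBall vbar ε).tendsto_subseq'
    (x := v) (hclose.mono fun k hk => by
      rw [Metric.mem_closedBall, dist_eq_norm]; exact hk.le).frequently
  have hfin : FiniteAt h (p + L d) := finiteAt_of_add_coe (H := fun d => h (p + L d)) hd.1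
  refine ⟨w, ⟨hfin, _, _, hy'.comp hφ.tendsto_atTop, hhy.comp hφ.tendsto_atTop,
    fun k => hv (φ k), hw⟩, ?_, by rwa [Metric.mem_closedBall, dist_eq_norm] at hwmem⟩
  exact tendsto_nhds_unique (((ContinuousLinearMap.adjoint L).continuous.tendsto w).comp hw)
    (hvb'.comp hφ.tendsto_atTop)

end Multipliers

/-! ### Hypomonotonicity and identification of the manifold -/

section Identification

variable {Y : Type*} [NormedAddCommGroup Y] [InnerProductSpace ℝ Y]

/-- The localized subgradient inequality of prox-regularity, with constant `ρ`. -/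
def LocalProxInequality (h : Y → EReal) (x v : Y) (ρ : ℝ) : Prop :=
  ∃ δ : ℝ, 0 < δ ∧ ∃ U ∈ 𝓝 (h x), ∀ y z w : Y, ‖y - x‖ < δ → ‖z - x‖ < δ → h y ∈ U →
    w ∈ subdifferential h y → ‖w - v‖ < δ →
    h y + ((inner ℝ w (z - y) - ρ / 2 * ‖z - y‖ ^ 2 : ℝ) : EReal) ≤ h z

theorem ProxRegularAtFor.exists_localProxInequality {h : Y → EReal} {x v : Y}
    (hp : ProxRegularAtFor h x v) : ∃ ρ : ℝ, 0 < ρ ∧ LocalProxInequality h x v ρ := by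
  obtain ⟨hfin, -, ρ, hρ, ε, hε, hineq⟩ := hp
  obtain ⟨a, ha⟩ := hfin.exists_real
  refine ⟨ρ, hρ, ε, hε, Set.Ioo (h x - (ε : EReal)) (h x + (ε : EReal)), ?_,
    fun y z w hy hz hU hw hwv => hineq y z w hy hz hU.1 hU.2 hw hwv⟩
  rw [ha]
  refine Ioo_mem_nhds ?_ ?_
  · exact_mod_cast sub_lt_self a hε
  · exact_mod_cast lt_add_of_pos_right a hε

/-- The constant 0 is what removes the threshold on the proximal parameter in the convex case. -/
theorem ConvexLsc.localProxInequality {h : Y → EReal} (hh : ConvexLsc h) (x v : Y) :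
    LocalProxInequality h x v 0 :=
  ⟨1, one_pos, Set.univ, univ_mem, fun y z w _ _ _ hw _ => by
    simpa using subgradient_convex_ineq hh hw z⟩

/-- Hypomonotonicity of the subdifferential, from two subgradient inequalities. -/
theorem inner_sub_le_of_prox {h : Y → EReal} {y z v w : Y} {ρ : ℝ}
    (hy : FiniteAt h y) (hz : FiniteAt h z)
    (h1 : h y + ((inner ℝ v (z - y) - ρ / 2 * ‖z - y‖ ^ 2 : ℝ) : EReal) ≤ h z)
    (h2 : h z + ((inner ℝ w (y - z) - ρ / 2 * ‖y - z‖ ^ 2 : ℝ) : EReal) ≤ h y) :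
    inner ℝ (v - w) (z - y) ≤ ρ * ‖z - y‖ ^ 2 := by
  obtain ⟨a, ha⟩ := hy.exists_real
  obtain ⟨b, hb⟩ := hz.exists_real
  rw [ha, hb] at h1 h2
  norm_cast at h1 h2
  have e : inner ℝ w (y - z) = -inner ℝ w (z - y) := by rw [← inner_neg_right, neg_sub]
  rw [norm_sub_rev y z, e] at h2
  rw [inner_sub_left]
  linarith

theorem exists_ball_subset_of_mem_intrinsicInterior {S : Set Y} {v : Y}
    (hv : v ∈ intrinsicInterior ℝ S) :
    ∃ ε : ℝ, 0 < ε ∧ ∀ e ∈ (affineSpan ℝ S).direction, ‖e‖ < ε → v + e ∈ S := by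
  obtain ⟨y, hy, rfl⟩ := mem_intrinsicInterior.1 hv
  obtain ⟨ε, hε, hball⟩ := Metric.mem_nhds_iff.1 (mem_interior_iff_mem_nhds.1 hy)
  refine ⟨ε, hε, fun e he hlt => ?_⟩
  have hmem : (y : Y) + e ∈ affineSpan ℝ S := by
    have := AffineSubspace.vadd_mem_of_mem_direction he y.2
    rwa [vadd_eq_add, add_comm] at this
  have : (⟨(y : Y) + e, hmem⟩ : affineSpan ℝ S) ∈ Metric.ball y ε := by
    rw [Metric.mem_ball, Subtype.dist_eq, dist_eq_norm]
    simpa using hlt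
  exact hball this

variable [FiniteDimensional ℝ Y]

/-- Points near a manifold can be moved onto it along the normal space at the base point. -/
theorem IsLocalDefiningMap.exists_normal_projection {M : Set Y} {x : Y} {k : ℕ}
    {F : Y → EuclideanSpace ℝ (Fin k)} (hF : IsLocalDefiningMap M x F) :
    ∃ κ : ℝ, 0 ≤ κ ∧ ∀ᶠ y in 𝓝 x, ∃ e : EuclideanSpace ℝ (Fin k),
      F (y + ContinuousLinearMap.adjoint (fderiv ℝ F x) e) = 0 ∧ ‖e‖ ≤ κ * ‖F y‖ := by
  obtain ⟨hxM, hFC, hsurj, hloc⟩ := hF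
  set A := fderiv ℝ F x with hA
  have hs : HasStrictFDerivAt F A x := hFC.hasStrictFDerivAt (by norm_num)
  set Q : Y × EuclideanSpace ℝ (Fin k) →L[ℝ] Y :=
    ContinuousLinearMap.fst ℝ _ _ +
      (ContinuousLinearMap.adjoint A).comp (ContinuousLinearMap.snd ℝ _ _) with hQ
  have hQ0 : Q (x, 0) = x := by simp [hQ]
  have hΨ : HasStrictFDerivAt (fun t => F (Q t)) (A.comp Q) (x, 0) := by
    have h1 : HasStrictFDerivAt F A (Q (x, 0)) := by rwa [hQ0]
    exact h1.comp (x, 0) Q.hasStrictFDerivAt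
  have hFx : F x = 0 := (hloc.self_of_nhds).1 hxM
  -- A A* e = 0 forces A* e = 0, and A* is injective because A is onto; so normal displacements
  -- alone solve F = 0.
  have hinj : Function.Injective (A ∘L ContinuousLinearMap.adjoint A) := by
    rw [injective_iff_map_eq_zero]
    intro e he
    have h1 : ContinuousLinearMap.adjoint A e = 0 := by
      rw [← inner_self_eq_zero (𝕜 := ℝ), ContinuousLinearMap.adjoint_inner_left]
      have : A (ContinuousLinearMap.adjoint A e) = 0 := he
      rw [this, inner_zero_right]
    obtain ⟨y, rfl⟩ := hsurj e
    rw [← inner_self_eq_zero (𝕜 := ℝ), ← ContinuousLinearMap.adjoint_inner_left, h1,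
      inner_zero_left]
  have hsur : Function.Surjective (A ∘L ContinuousLinearMap.adjoint A) :=
    LinearMap.injective_iff_surjective
      (f := (A ∘L ContinuousLinearMap.adjoint A).toLinearMap).1 hinj
  obtain ⟨κ, hκ, hev⟩ := exists_zero_norm_le_of_partial_surjective hΨ (fun e => by
    obtain ⟨d, hd⟩ := hsur e
    exact ⟨d, by simpa [hQ] using hd⟩) (by simp only [hQ0, hFx])
  refine ⟨κ, hκ, hev.mono fun y ⟨d, hd1, hd2⟩ => ⟨d, ?_, ?_⟩⟩
  · simpa [hQ] using hd1
  · simpa [hQ] using hd2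

/-- Identification: subgradients near a relative interior subgradient, at points near the base
point, can only occur on the active manifold. -/
theorem eventually_mem_manifold {h : Y → EReal} {M : Set Y} {x vbar : Y} {k : ℕ} {ρ : ℝ}
    {F : Y → EuclideanSpace ℝ (Fin k)} {g : Y → ℝ}
    (hF : IsLocalDefiningMap M x F) (hgc : ContinuousAt g x)
    (hg : ∀ᶠ z in 𝓝[M] x, h z = (g z : EReal))
    (hpar : (affineSpan ℝ (subdifferential h x)).direction =
      LinearMap.range (ContinuousLinearMap.adjoint (fderiv ℝ F x)).toLinearMap)
    (hcont : subdifferential h x ⊆ innerLimit (subdifferential h) M x)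
    (hprox : LocalProxInequality h x vbar ρ)
    (hvbar : vbar ∈ intrinsicInterior ℝ (subdifferential h x)) :
    ∀ᶠ q : (Y × EReal) × Y in 𝓝 ((x, h x), vbar),
      q.2 ∈ subdifferential h q.1.1 → h q.1.1 = q.1.2 → q.1.1 ∈ M := by
  by_contra hcon
  rw [not_eventually] at hcon
  obtain ⟨q, hq, hprop⟩ := exists_seq_forall_of_frequently hcon
  push Not at hprop
  set y : ℕ → Y := fun j => (q j).1.1 with hy_def
  set v : ℕ → Y := fun j => (q j).2 with hv_def
  have hv : ∀ j, v j ∈ subdifferential h (y j) := fun j => (hprop j).1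
  have hyM : ∀ j, y j ∉ M := fun j => (hprop j).2.2
  have hy : Tendsto y atTop (𝓝 x) :=
    ((continuous_fst.comp continuous_fst).tendsto _).comp hq
  have hhy : Tendsto (fun j => h (y j)) atTop (𝓝 (h x)) := by
    have : (fun j => h (y j)) = fun j => (q j).1.2 := funext fun j => (hprop j).2.1
    rw [this]
    exact ((continuous_snd.comp continuous_fst).tendsto _).comp hq
  have hvv : Tendsto v atTop (𝓝 vbar) := (continuous_snd.tendsto _).comp hq
  obtain ⟨κ, hκ, hproj⟩ := hF.exists_normal_projection
  obtain ⟨e, he⟩ := (hy.eventually hproj).choice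
  set A := fderiv ℝ F x with hA
  set n : ℕ → Y := fun j => ContinuousLinearMap.adjoint A (e j) with hn
  have hFx : F x = 0 := (hF.2.2.2.self_of_nhds).1 hF.1
  have he0 : Tendsto e atTop (𝓝 0) := by
    have h1 : Tendsto (fun j => κ * ‖F (y j)‖) atTop (𝓝 0) := by
      have := ((hF.2.1.continuousAt.tendsto.comp hy).norm).const_mul κ
      simpa [hFx, Function.comp_def] using this
    exact squeeze_zero_norm' (he.mono fun j hj => hj.2) h1
  have hn0 : Tendsto n atTop (𝓝 0) := by
    have := ((ContinuousLinearMap.adjoint A).continuous.tendsto 0).comp he0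
    simpa [Function.comp_def] using this
  have hp : Tendsto (fun j => y j + n j) atTop (𝓝 x) := by simpa using hy.add hn0
  have hpM : ∀ᶠ j in atTop, y j + n j ∈ M := by
    filter_upwards [he, hp.eventually hF.2.2.2] with j h1 h2 using h2.2 h1.1
  have hpW : Tendsto (fun j => y j + n j) atTop (𝓝[M] x) := tendsto_nhdsWithin_iff.2 ⟨hp, hpM⟩
  have hxg : h x = (g x : EReal) := hg.self_of_nhdsWithin hF.1
  have hhp : Tendsto (fun j => h (y j + n j)) atTop (𝓝 (h x)) := by
    rw [hxg]
    refine ((continuous_coe_real_ereal.tendsto _).comp (hgc.tendsto.comp hp)).congr' ?_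
    filter_upwards [hpW.eventually hg] with j hj using hj.symm
  set N := (affineSpan ℝ (subdifferential h x)).direction with hN
  -- Unit normal directions from the projected point y + n back to y, which is off `M`.
  set f : ℕ → Y := fun j => (-(‖n j‖)⁻¹) • n j with hf
  have hfN : ∀ j, f j ∈ N := fun j => by
    rw [hpar]; exact Submodule.smul_mem _ _ ⟨e j, rfl⟩
  have hn_ne : ∀ᶠ j in atTop, n j ≠ 0 := by
    filter_upwards [hpM] with j hj h0
    rw [h0, add_zero] at hj
    exact hyM j hj
  have hfnorm : ∀ᶠ j in atTop, ‖f j‖ = 1 := by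
    filter_upwards [hn_ne] with j hj
    rw [hf, norm_smul, norm_neg, norm_inv, norm_norm, inv_mul_cancel₀ (norm_ne_zero_iff.2 hj)]
  obtain ⟨f₀, -, φ, hφ, hf₀⟩ := (isCompact_closedBall (0 : Y) 1).tendsto_subseq' (x := f)
    (hfnorm.mono fun j hj => by rw [mem_closedBall_zero_iff, hj]).frequently
  have hf₀N : f₀ ∈ N :=
    (Submodule.closed_of_finiteDimensional N).mem_of_tendsto hf₀
      (Eventually.of_forall fun j => hfN (φ j))
  have hf₀1 : ‖f₀‖ = 1 :=
    tendsto_nhds_unique hf₀.norm ((tendsto_const_nhds).congr' (by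
      filter_upwards [hφ.tendsto_atTop.eventually hfnorm] with j hj using hj.symm))
  obtain ⟨ε₀, hε₀, hball⟩ := exists_ball_subset_of_mem_intrinsicInterior hvbar
  obtain ⟨δ, hδ, U, hU, hineq⟩ := hprox
  -- Below ε₀, the tilted vector vbar + ε f₀ is still a subgradient at x; below δ, subgradients
  -- within ε/4 of it remain in the range of the prox inequality.
  set ε := min (ε₀ / 2) (δ / 2) with hεdef
  have hε : 0 < ε := by positivity
  have hεε₀ : ε < ε₀ := (min_le_left _ _).trans_lt (by linarith)
  have hεδ : ε ≤ δ / 2 := min_le_right _ _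
  have hmem : vbar + ε • f₀ ∈ subdifferential h x :=
    hball _ (Submodule.smul_mem _ _ hf₀N) (by
      rw [norm_smul, hf₀1, mul_one, Real.norm_of_nonneg hε.le]; exact hεε₀)
  have hlim := hcont hmem (ε / 4) (by positivity)
  have hinner : Tendsto (fun j => inner ℝ f₀ (f (φ j))) atTop (𝓝 1) := by
    have := (tendsto_const_nhds (x := f₀)).inner hf₀ (𝕜 := ℝ)
    rwa [real_inner_self_eq_norm_sq, hf₀1, one_pow] at this
  have hφt := hφ.tendsto_atTop
  have hyn := (tendsto_iff_norm_sub_tendsto_zero.1 hy).eventually_lt_const hδ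
  have hpn := (tendsto_iff_norm_sub_tendsto_zero.1 hp).eventually_lt_const hδ
  have hvn := (tendsto_iff_norm_sub_tendsto_zero.1 hvv).eventually_lt_const
    (show 0 < ε / 4 by positivity)
  have hρn : ∀ᶠ j in atTop, ρ * ‖n j‖ < ε / 8 := by
    have : Tendsto (fun j => ρ * ‖n j‖) atTop (𝓝 0) := by simpa using hn0.norm.const_mul ρ
    exact this.eventually_lt_const (by positivity)
  have hall := hφt.eventually ((hpW.eventually hlim).and ((hhy.eventually hU).and
    ((hhp.eventually hU).and (hyn.and (hpn.and (hvn.and (hρn.and (hn_ne.and hfnorm))))))))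
  obtain ⟨j, ⟨⟨w, hw, hwn⟩, hyU, hpU, hyδ, hpδ, hvε, hρε, hnj, hf1⟩, hin⟩ :=
    (hall.and (hinner.eventually_const_lt (show (3 : ℝ) / 4 < 1 by norm_num))).exists
  set i := φ j
  have hwδ : ‖w - vbar‖ < δ := by
    have h1 : w - vbar = (w - (vbar + ε • f₀)) + ε • f₀ := by abel
    rw [h1]
    refine (norm_add_le _ _).trans_lt ?_
    rw [norm_smul, hf₀1, mul_one, Real.norm_of_nonneg hε.le]
    linarith
  -- Hypomonotonicity between y + n (subgradient w near vbar + ε f₀) and y (subgradient v near vbar)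
  -- gives ⟪w - v, f⟫ ≤ ρ‖n‖ < ε/8, whereas the left side exceeds 3ε/4 - ε/4 - ε/4.
  have h1 := hineq (y i + n i) (y i) w hpδ hyδ hpU hw hwδ
  have h2 := hineq (y i) (y i + n i) (v i) hyδ hpδ hyU (hv i) (by linarith)
  have h3 := inner_sub_le_of_prox hw.1 (hv i).1 h1 h2
  have e1 : y i - (y i + n i) = ‖n i‖ • f i := by
    simp only [hf]
    rw [smul_smul, mul_neg, mul_inv_cancel₀ (norm_ne_zero_iff.2 hnj)]
    simp
  rw [e1, norm_smul, norm_norm, hf1, mul_one, inner_smul_right] at h3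
  have hnpos : 0 < ‖n i‖ := norm_pos_iff.2 hnj
  have h4 : inner ℝ (w - v i) (f i) ≤ ρ * ‖n i‖ := by
    refine le_of_mul_le_mul_left ?_ hnpos
    linarith
  have e2 : w - v i = ε • f₀ + ((w - (vbar + ε • f₀)) - (v i - vbar)) := by abel
  rw [e2, inner_add_left, inner_smul_left] at h4
  have h5 := abs_le.1 (abs_real_inner_le_norm ((w - (vbar + ε • f₀)) - (v i - vbar)) (f i))
  rw [hf1, mul_one] at h5
  have h6 := norm_sub_le (w - (vbar + ε • f₀)) (v i - vbar)
  have h7 : ε * (3 / 4) < ε * inner ℝ f₀ (f i) := mul_lt_mul_of_pos_left hin hε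
  simp only [conj_trivial] at h4
  linarith [h5.1]

end Identification

/-! ### Second-order upper bound along the manifold -/

section ManifoldEstimates

variable {Y : Type*} [NormedAddCommGroup Y] [InnerProductSpace ℝ Y] [FiniteDimensional ℝ Y]

/-- Along the manifold, `h` is bounded above by its linearization given by the subgradient `v`,
up to a quadratic term: by the Lagrange multiplier rule, `v` and the gradient of the smooth
representative of `h` differ by a normal vector. -/
theorem exists_quadratic_upper_bound {h : Y → EReal} {M : Set Y} {x v : Y} {k : ℕ} {ρ : ℝ}
    {F : Y → EuclideanSpace ℝ (Fin k)} {g : Y → ℝ}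
    (hF : IsLocalDefiningMap M x F) (hgC : ContDiffAt ℝ 2 g x)
    (hg : ∀ᶠ z in 𝓝[M] x, h z = (g z : EReal))
    (hlow : ∀ᶠ z in 𝓝 x,
      ((g x + inner ℝ v (z - x) - ρ / 2 * ‖z - x‖ ^ 2 : ℝ) : EReal) ≤ h z) :
    ∃ C : ℝ, 0 ≤ C ∧ ∀ᶠ z in 𝓝 x, z ∈ M →
      h z ≤ ((g x + inner ℝ v (z - x) + C * ‖z - x‖ ^ 2 : ℝ) : EReal) := by
  obtain ⟨hxM, hFC, hsurj, hloc⟩ := hF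
  have hFx : F x = 0 := (hloc.self_of_nhds).1 hxM
  -- By the lower bound on h, x minimizes φ locally on the manifold; the quadratic term has zero
  -- derivative at x.
  set φ : Y → ℝ := fun z => g z - inner ℝ v (z - x) + ρ / 2 * ‖z - x‖ ^ 2 with hφ
  have hg' := hgC.hasStrictFDerivAt (by norm_num)
  have hsub : HasStrictFDerivAt (fun z : Y => z - x) (ContinuousLinearMap.id ℝ Y) x :=
    (hasStrictFDerivAt_id x).sub_const x
  have hin : HasStrictFDerivAt (fun z : Y => inner ℝ v (z - x)) (innerSL ℝ v) x := by
    have := HasStrictFDerivAt.comp x (g := innerSL ℝ v) (f := fun z => z - x)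
      (innerSL ℝ v).hasStrictFDerivAt hsub
    simpa [Function.comp_def] using this
  have hsq : HasStrictFDerivAt (fun z : Y => ρ / 2 * ‖z - x‖ ^ 2) (0 : Y →L[ℝ] ℝ) x := by
    have h1 := HasStrictFDerivAt.comp x (g := fun y : Y => ‖y‖ ^ 2) (f := fun z => z - x)
      (hasStrictFDerivAt_norm_sq (x - x)) hsub
    have := HasStrictFDerivAt.const_mul h1 (ρ / 2)
    simpa [Function.comp_def] using this
  have hφ' : HasStrictFDerivAt φ (fderiv ℝ g x - innerSL ℝ v + 0) x := (hg'.sub hin).add hsq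
  have hmin : IsLocalExtrOn φ {z | F z = F x} x := by
    left
    have h1 : ∀ᶠ z in 𝓝 x, z ∈ M → h z = (g z : EReal) := eventually_nhdsWithin_iff.1 hg
    refine eventually_nhdsWithin_iff.2 ?_
    filter_upwards [h1, hlow, hloc] with z h1 h2 h3 hz
    rw [h1 (h3.2 (hz.trans hFx))] at h2
    have h2 := EReal.coe_le_coe_iff.1 h2
    simp only [hφ, sub_self, inner_zero_right, norm_zero]
    linarith
  obtain ⟨Λ, Λ₀, hne, hΛ⟩ := hmin.exists_linear_map_of_hasStrictFDerivAt
    (hFC.hasStrictFDerivAt (by norm_num)) hφ'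
  -- Surjectivity of the constraint derivative excludes an abnormal multiplier.
  have hΛ₀ : Λ₀ ≠ 0 := by
    rintro rfl
    apply hne
    have : Λ = 0 := by
      ext e
      obtain ⟨y, rfl⟩ := hsurj e
      simpa using hΛ y
    rw [this]; rfl
  obtain ⟨Cg, hCg, δg, hδg, hgq⟩ := ContDiffAt.exists_quadratic_remainder hgC
  obtain ⟨CF, hCF, δF, hδF, hFq⟩ := ContDiffAt.exists_quadratic_remainder hFC
  set Λc : EuclideanSpace ℝ (Fin k) →L[ℝ] ℝ := LinearMap.toContinuousLinearMap (Λ : _ →ₗ[ℝ] ℝ)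
  refine ⟨|Λ₀⁻¹| * (‖Λc‖ * CF) + Cg, by positivity, ?_⟩
  filter_upwards [eventually_nhdsWithin_iff.1 hg, hloc, Metric.ball_mem_nhds x hδg,
    Metric.ball_mem_nhds x hδF] with z h1 h2 h3 h4 hz
  rw [Metric.mem_ball, dist_eq_norm] at h3 h4
  rw [h1 hz, EReal.coe_le_coe_iff]
  have e1 := (hgq x z (by simpa using hδg) h3).2
  have e2 := (hFq x z (by simpa using hδF) h4).2
  rw [h2.1 hz, hFx, sub_self, zero_sub, norm_neg] at e2
  -- The normal part is quadratically small on `M`: F vanishes at both x and z, so its derivative on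
  -- z - x is only the Taylor remainder.
  have e3 : fderiv ℝ g x (z - x) = inner ℝ v (z - x) - Λ₀⁻¹ * Λc (fderiv ℝ F x (z - x)) := by
    have := hΛ (z - x)
    simp only [add_zero, _root_.sub_apply, innerSL_apply_apply, smul_eq_mul] at this
    have e : Λc (fderiv ℝ F x (z - x)) = Λ (fderiv ℝ F x (z - x)) := rfl
    rw [e]
    field_simp
    linarith
  have e4 : |Λ₀⁻¹ * Λc (fderiv ℝ F x (z - x))| ≤ |Λ₀⁻¹| * (‖Λc‖ * CF) * ‖z - x‖ ^ 2 := by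
    rw [abs_mul, mul_assoc, mul_assoc]
    refine mul_le_mul_of_nonneg_left ?_ (abs_nonneg _)
    exact (Λc.le_opNorm _).trans (mul_le_mul_of_nonneg_left e2 (norm_nonneg _))
  have e5 := (abs_le.1 e4).1
  have e6 := (abs_le.1 (Real.norm_eq_abs _ ▸ e1)).2
  linarith

end ManifoldEstimates

/-! ### The linearized subproblem: feasibility, correction, local minimizers -/

section Subproblems

variable {n m : ℕ} {h : EuclideanSpace ℝ (Fin m) → EReal}
  {c : EuclideanSpace ℝ (Fin n) → EuclideanSpace ℝ (Fin m)}
  {xbar : EuclideanSpace ℝ (Fin n)} {M : Set (EuclideanSpace ℝ (Fin m))}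

/-- Both partial derivatives equal ∇c(x̄), since the second derivative of c enters only multiplied
by d = 0. -/
theorem hasStrictFDerivAt_pred (hc : ContDiffAt ℝ 2 c xbar) :
    HasStrictFDerivAt (fun t : EuclideanSpace ℝ (Fin n) × EuclideanSpace ℝ (Fin n) =>
        pred c t.1 t.2)
      ((fderiv ℝ c xbar).comp (ContinuousLinearMap.fst ℝ _ _) +
        (fderiv ℝ c xbar).comp (ContinuousLinearMap.snd ℝ _ _)) (xbar, 0) := by
  have h1 : HasStrictFDerivAt c (fderiv ℝ c xbar) xbar := hc.hasStrictFDerivAt (by norm_num)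
  have h2 : HasStrictFDerivAt (fderiv ℝ c) (fderiv ℝ (fderiv ℝ c) xbar) xbar :=
    (hc.fderiv_right (m := 1) (by norm_num)).hasStrictFDerivAt (by norm_num)
  have hfst : HasStrictFDerivAt (Prod.fst : EuclideanSpace ℝ (Fin n) × EuclideanSpace ℝ (Fin n) → _)
    (ContinuousLinearMap.fst ℝ _ _) (xbar, 0) := hasStrictFDerivAt_fst
  have hsnd : HasStrictFDerivAt (Prod.snd : EuclideanSpace ℝ (Fin n) × EuclideanSpace ℝ (Fin n) → _)
    (ContinuousLinearMap.snd ℝ _ _) (xbar, 0) := hasStrictFDerivAt_snd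
  have h3 := HasStrictFDerivAt.comp (xbar, (0 : EuclideanSpace ℝ (Fin n))) (g := c)
    (f := Prod.fst) h1 hfst
  have h4 := HasStrictFDerivAt.comp (xbar, (0 : EuclideanSpace ℝ (Fin n))) (g := fderiv ℝ c)
    (f := Prod.fst) h2 hfst
  have h5 := h3.add (h4.clm_apply hsnd)
  refine h5.congr_fderiv ?_
  ext t <;> simp

theorem tendsto_pred (hc : ContDiffAt ℝ 2 c xbar) :
    Tendsto (fun t : EuclideanSpace ℝ (Fin n) × EuclideanSpace ℝ (Fin n) => pred c t.1 t.2)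
      (𝓝 (xbar, 0)) (𝓝 (c xbar)) := by
  have := (hasStrictFDerivAt_pred hc).continuousAt.tendsto
  simpa [pred] using this

theorem continuous_pred (x : EuclideanSpace ℝ (Fin n)) : Continuous (pred c x) := by
  unfold pred; fun_prop

/-- Transversality: the constraint qualification makes `F ∘ c` a submersion. -/
theorem surjective_fderiv_comp {k : ℕ}
    {A : EuclideanSpace ℝ (Fin n) →L[ℝ] EuclideanSpace ℝ (Fin m)}
    {B : EuclideanSpace ℝ (Fin m) →L[ℝ] EuclideanSpace ℝ (Fin k)}
    (hB : Function.Surjective B)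
    (hcq : LinearMap.range (ContinuousLinearMap.adjoint B).toLinearMap ⊓
      LinearMap.ker (ContinuousLinearMap.adjoint A).toLinearMap = ⊥) :
    Function.Surjective (B.comp A) := by
  -- A vector e orthogonal to the range satisfies A*B*e = 0, so B*e lies in the trivial
  -- intersection.
  have hbot : (LinearMap.range (B.comp A).toLinearMap)ᗮ = ⊥ := by
    rw [eq_bot_iff]
    intro e he
    rw [Submodule.mem_bot]
    have h1 : ContinuousLinearMap.adjoint A (ContinuousLinearMap.adjoint B e) = 0 := by
      rw [← inner_self_eq_zero (𝕜 := ℝ), ContinuousLinearMap.adjoint_inner_left,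
        ContinuousLinearMap.adjoint_inner_left, real_inner_comm]
      exact he _ ⟨_, rfl⟩
    have h2 : ContinuousLinearMap.adjoint B e ∈
        LinearMap.range (ContinuousLinearMap.adjoint B).toLinearMap ⊓
        LinearMap.ker (ContinuousLinearMap.adjoint A).toLinearMap := ⟨⟨e, rfl⟩, h1⟩
    rw [hcq, Submodule.mem_bot] at h2
    obtain ⟨y, rfl⟩ := hB e
    rw [← inner_self_eq_zero (𝕜 := ℝ), ← ContinuousLinearMap.adjoint_inner_left, h2,
      inner_zero_left]
  exact LinearMap.range_eq_top.1 ((Submodule.orthogonal_eq_bot_iff).1 hbot)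

/-- Near `xbar`, the linearization of `c` can be moved onto the manifold by a small step. -/
theorem exists_feasible_step {k : ℕ} {F : EuclideanSpace ℝ (Fin m) → EuclideanSpace ℝ (Fin k)}
    (hc : ContDiffAt ℝ 2 c xbar) (hF : IsLocalDefiningMap M (c xbar) F)
    (htrans : Function.Surjective ((fderiv ℝ F (c xbar)).comp (fderiv ℝ c xbar))) :
    ∃ κ : ℝ, 0 ≤ κ ∧ ∀ᶠ x in 𝓝 xbar, ∃ d, pred c x d ∈ M ∧ ‖d‖ ≤ κ * ‖x - xbar‖ := by
  obtain ⟨hxM, hFC, -, hloc⟩ := hF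
  have hFx : F (c xbar) = 0 := (hloc.self_of_nhds).1 hxM
  have hp0 : pred c xbar 0 = c xbar := by simp [pred]
  have hΨ := HasStrictFDerivAt.comp (xbar, (0 : EuclideanSpace ℝ (Fin n))) (g := F)
    (f := fun t : EuclideanSpace ℝ (Fin n) × EuclideanSpace ℝ (Fin n) => pred c t.1 t.2)
    (g' := fderiv ℝ F (c xbar))
    (by simpa only [hp0] using hFC.hasStrictFDerivAt (by norm_num)) (hasStrictFDerivAt_pred hc)
  obtain ⟨κ, hκ, hev⟩ := exists_zero_norm_le_of_partial_surjective hΨ (fun e => by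
    obtain ⟨d, hd⟩ := htrans e
    exact ⟨d, by simpa using hd⟩) (by simp [hp0, hFx])
  obtain ⟨Lc, t, ht, hLip⟩ := ((hFC.of_le (m := 1) (by norm_num)).comp xbar
    (hc.of_le (m := 1) (by norm_num))).exists_lipschitzOnWith
  obtain ⟨V, hV, W, hW, hVW⟩ := mem_nhds_prod_iff.1 ((tendsto_pred hc).eventually hloc)
  obtain ⟨r, hr, hrW⟩ := Metric.mem_nhds_iff.1 hW
  refine ⟨κ * Lc, by positivity, ?_⟩
  have hsmall : ∀ᶠ x in 𝓝 xbar, κ * Lc * ‖x - xbar‖ < r := by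
    have : Continuous fun x : EuclideanSpace ℝ (Fin n) => κ * Lc * ‖x - xbar‖ := by fun_prop
    exact (this.tendsto xbar).eventually_lt_const (by simpa using hr)
  filter_upwards [hev, ht, hV, hsmall] with x ⟨d, hd1, hd2⟩ hxt hxV hxr
  have hbd : ‖d‖ ≤ κ * Lc * ‖x - xbar‖ := by
    refine hd2.trans ?_
    rw [mul_assoc]
    refine mul_le_mul_of_nonneg_left ?_ hκ
    have := hLip.norm_sub_le hxt (mem_of_mem_nhds ht)
    simpa [pred, hFx] using this
  have hmem : (x, d) ∈ V ×ˢ W :=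
    ⟨hxV, hrW (by rw [mem_ball_zero_iff]; exact hbd.trans_lt hxr)⟩
  exact ⟨d, (hVW hmem).2 hd1, hbd⟩

/-- Steps that identify the manifold can be corrected to points mapped into the manifold. -/
theorem exists_correction_constant {k : ℕ}
    {F : EuclideanSpace ℝ (Fin m) → EuclideanSpace ℝ (Fin k)} {g : EuclideanSpace ℝ (Fin m) → ℝ}
    (hc : ContDiffAt ℝ 2 c xbar) (hF : IsLocalDefiningMap M (c xbar) F)
    (hgC : ContDiffAt ℝ 2 g (c xbar)) (hg : ∀ᶠ z in 𝓝[M] (c xbar), h z = (g z : EReal))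
    (htrans : Function.Surjective ((fderiv ℝ F (c xbar)).comp (fderiv ℝ c xbar))) :
    ∃ γ : ℝ, 0 ≤ γ ∧ ∀ᶠ t : EuclideanSpace ℝ (Fin n) × EuclideanSpace ℝ (Fin n) in 𝓝 (xbar, 0),
      pred c t.1 t.2 ∈ M → IdentifiesAndCorrects h c M γ t.1 t.2 := by
  obtain ⟨hxM, hFC, -, hloc⟩ := hF
  have hFx : F (c xbar) = 0 := (hloc.self_of_nhds).1 hxM
  set Q : EuclideanSpace ℝ (Fin n) × EuclideanSpace ℝ (Fin n) →L[ℝ] EuclideanSpace ℝ (Fin n) :=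
    ContinuousLinearMap.fst ℝ _ _ + ContinuousLinearMap.snd ℝ _ _ with hQ
  have hQ0 : Q (xbar, 0) = xbar := by simp [hQ]
  have hFc : HasStrictFDerivAt (F ∘ c) ((fderiv ℝ F (c xbar)).comp (fderiv ℝ c xbar)) xbar :=
    (hFC.hasStrictFDerivAt (by norm_num)).comp xbar (hc.hasStrictFDerivAt (by norm_num))
  have hΨ := HasStrictFDerivAt.comp (xbar, (0 : EuclideanSpace ℝ (Fin n))) (g := F ∘ c) (f := Q)
    (by simpa only [hQ0] using hFc) Q.hasStrictFDerivAt
  obtain ⟨κ, hκ, hev⟩ := exists_zero_norm_le_of_partial_surjective hΨ (fun e => by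
    obtain ⟨d, hd⟩ := htrans e
    exact ⟨d, by simpa [hQ] using hd⟩) (by simp [hQ0, hFx])
  obtain ⟨C, hC, δ, hδ, hquad⟩ := ContDiffAt.exists_quadratic_remainder hc
  obtain ⟨LF, tF, htF, hLF⟩ := (hFC.of_le (m := 1) (by norm_num)).exists_lipschitzOnWith
  obtain ⟨Lg, tg, htg, hLg⟩ := (hgC.of_le (m := 1) (by norm_num)).exists_lipschitzOnWith
  obtain ⟨Lc, tc, htc, hLc⟩ := (hc.of_le (m := 1) (by norm_num)).exists_lipschitzOnWith
  have hgood : ∀ᶠ z in 𝓝 (c xbar),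
      z ∈ tF ∧ z ∈ tg ∧ (z ∈ M ↔ F z = 0) ∧ (z ∈ M → h z = (g z : EReal)) := by
    filter_upwards [htF, htg, hloc, eventually_nhdsWithin_iff.1 hg] with z h1 h2 h3 h4
      using ⟨h1, h2, h3, h4⟩
  obtain ⟨r, hr, hball⟩ := Metric.mem_nhds_iff.1
    ((hc.continuousAt.tendsto.eventually hgood).and htc)
  -- F vanishes at the prediction, so F(c(x + d)) is at most LF times the linearization error C‖d‖²;
  -- solving F ∘ c = 0 from x + d multiplies this by κ.
  set κ' : ℝ := κ * (LF * C) with hκ'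
  have hκ'0 : 0 ≤ κ' := by positivity
  set γ : ℝ := κ' + Lg * (Lc * κ' + C) with hγ
  have hγκ : κ' ≤ γ := by rw [hγ]; exact le_add_of_nonneg_right (by positivity)
  refine ⟨γ, by positivity, ?_⟩
  have hsum : Tendsto (fun t : EuclideanSpace ℝ (Fin n) × EuclideanSpace ℝ (Fin n) => t.1 + t.2)
      (𝓝 (xbar, 0)) (𝓝 xbar) := by
    have : Continuous fun t : EuclideanSpace ℝ (Fin n) × EuclideanSpace ℝ (Fin n) => t.1 + t.2 := by
      fun_prop
    simpa using this.tendsto (xbar, 0)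
  have hfst : Tendsto (fun t : EuclideanSpace ℝ (Fin n) × EuclideanSpace ℝ (Fin n) => t.1)
      (𝓝 (xbar, 0)) (𝓝 xbar) := continuous_fst.tendsto (xbar, 0)
  have hsmall : ∀ᶠ t : EuclideanSpace ℝ (Fin n) × EuclideanSpace ℝ (Fin n) in 𝓝 (xbar, 0),
      ‖t.1 + t.2 - xbar‖ + κ' * ‖t.2‖ ^ 2 < r := by
    have : Continuous fun t : EuclideanSpace ℝ (Fin n) × EuclideanSpace ℝ (Fin n) =>
        ‖t.1 + t.2 - xbar‖ + κ' * ‖t.2‖ ^ 2 := by fun_prop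
    exact (this.tendsto (xbar, 0)).eventually_lt_const (by simpa using hr)
  filter_upwards [hsum.eventually hev, hfst.eventually (Metric.ball_mem_nhds xbar hδ),
    hsum.eventually (Metric.ball_mem_nhds xbar hδ), hsmall, (tendsto_pred hc).eventually hgood]
    with ⟨x, d⟩ ⟨e, he1, he2⟩ hx hxd hs hp hpM
  simp only [Function.comp_def, hQ, _root_.add_apply, ContinuousLinearMap.coe_fst',
    ContinuousLinearMap.coe_snd', add_zero] at hx hxd hs hp hpM he1 he2
  rw [dist_eq_norm] at hx hxd
  have hd2 : 0 ≤ κ' * ‖d‖ ^ 2 := by positivity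
  have hq := (hquad x (x + d) hx hxd).2
  have hq' : ‖c (x + d) - pred c x d‖ ≤ C * ‖d‖ ^ 2 := by
    have e1 : c (x + d) - pred c x d = c (x + d) - c x - fderiv ℝ c x (x + d - x) := by
      rw [add_sub_cancel_left, pred]; abel
    rw [e1]; simpa using hq
  have hxdg := hball (show x + d ∈ Metric.ball xbar r by
    rw [Metric.mem_ball, dist_eq_norm]; linarith)
  have hen : ‖e‖ ≤ κ' * ‖d‖ ^ 2 := by
    refine he2.trans ?_
    rw [hκ', mul_assoc]
    refine mul_le_mul_of_nonneg_left ?_ hκ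
    have h1 := hLF.norm_sub_le hxdg.1.1 hp.1
    rw [hp.2.2.1.1 hpM, sub_zero] at h1
    rw [mul_assoc]
    exact h1.trans (mul_le_mul_of_nonneg_left hq' LF.coe_nonneg)
  have hnewg := hball (show x + d + e ∈ Metric.ball xbar r by
    rw [Metric.mem_ball, dist_eq_norm]
    have : x + d + e - xbar = (x + d - xbar) + e := by abel
    rw [this]
    exact (norm_add_le _ _).trans_lt (by linarith))
  have hnewM : c (x + d + e) ∈ M := hnewg.1.2.2.1.2 he1
  refine ⟨hpM, x + d + e, hnewM, ?_, ?_⟩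
  · rw [add_sub_cancel_left]
    exact hen.trans (mul_le_mul_of_nonneg_right hγκ (by positivity))
  · rw [hnewg.1.2.2.2 hnewM, hp.2.2.2 hpM, ← EReal.coe_add, EReal.coe_le_coe_iff]
    have h1 := hLg.norm_sub_le hnewg.1.2.1 hp.2.1
    have h2 := hLc.norm_sub_le hnewg.2 hxdg.2
    rw [add_sub_cancel_left] at h2
    have h3 := norm_sub_le_norm_sub_add_norm_sub (c (x + d + e)) (c (x + d)) (pred c x d)
    have h4 : ‖c (x + d + e) - pred c x d‖ ≤ (Lc * κ' + C) * ‖d‖ ^ 2 := by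
      have := mul_le_mul_of_nonneg_left hen Lc.coe_nonneg
      linarith
    have h5 := h1.trans (mul_le_mul_of_nonneg_left h4 Lg.coe_nonneg)
    have h6 := (abs_le.1 (Real.norm_eq_abs _ ▸ h5)).2
    rw [hγ]
    linarith

/-- First-order estimates for the linearized prediction, at a critical subgradient `v`. -/
theorem exists_pred_estimates (hc : ContDiffAt ℝ 2 c xbar) {v : EuclideanSpace ℝ (Fin m)}
    (hv : ContinuousLinearMap.adjoint (fderiv ℝ c xbar) v = 0) :
    ∃ C : ℝ, 0 ≤ C ∧ ∀ᶠ x in 𝓝 xbar, ‖fderiv ℝ c x‖ ≤ ‖fderiv ℝ c xbar‖ + 1 ∧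
      ∀ d, ‖pred c x d - c xbar‖ ≤ C * ‖x - xbar‖ + (‖fderiv ℝ c xbar‖ + 1) * ‖d‖ ∧
        |inner ℝ v (pred c x d - c xbar)| ≤ C * (‖x - xbar‖ ^ 2 + ‖x - xbar‖ * ‖d‖) := by
  obtain ⟨Q, hQ, δ, hδ, hquad⟩ := ContDiffAt.exists_quadratic_remainder hc
  set A := fderiv ℝ c xbar with hA
  refine ⟨Q + ‖A‖ + ‖v‖ * Q, by positivity, ?_⟩
  have hs : ∀ᶠ x in 𝓝 xbar, ‖x - xbar‖ < min δ 1 ∧ Q * ‖x - xbar‖ < 1 := by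
    have h1 : Continuous fun x : EuclideanSpace ℝ (Fin n) => ‖x - xbar‖ := by fun_prop
    have h2 : Continuous fun x : EuclideanSpace ℝ (Fin n) => Q * ‖x - xbar‖ := by fun_prop
    exact ((h1.tendsto xbar).eventually_lt_const (by simpa using hδ)).and
      ((h2.tendsto xbar).eventually_lt_const (by simp))
  filter_upwards [hs] with x ⟨hx, hQx⟩
  obtain ⟨hl, hq⟩ := hquad xbar x (by simpa using hδ) (hx.trans_le (min_le_left _ _))
  have hs1 : ‖x - xbar‖ ≤ 1 := (hx.trans_le (min_le_right _ _)).le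
  set s := ‖x - xbar‖ with hs
  have hs0 : 0 ≤ s := norm_nonneg _
  have hnorm : ‖fderiv ℝ c x‖ ≤ ‖A‖ + 1 := by
    have := norm_le_norm_add_norm_sub' (fderiv ℝ c x) A
    linarith
  refine ⟨hnorm, fun d => ⟨?_, ?_⟩⟩
  · have e : pred c x d - c xbar =
        (c x - c xbar - A (x - xbar)) + A (x - xbar) + fderiv ℝ c x d := by
      rw [pred]; abel
    rw [e]
    have h1 := norm_add₃_le (a := c x - c xbar - A (x - xbar)) (b := A (x - xbar))
      (c := fderiv ℝ c x d)
    have h2 := A.le_opNorm (x - xbar)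
    have h3 := ((fderiv ℝ c x).le_opNorm d).trans
      (mul_le_mul_of_nonneg_right hnorm (norm_nonneg d))
    have h4 : Q * s ^ 2 ≤ Q * s := by
      refine mul_le_mul_of_nonneg_left ?_ hQ
      nlinarith
    have h5 : 0 ≤ ‖v‖ * Q * s := by positivity
    nlinarith
  · have e : pred c x d - c xbar = (c x - c xbar - A (x - xbar)) + (fderiv ℝ c x - A) d
        + A (x - xbar + d) := by
      rw [pred, map_add, _root_.sub_apply]; abel
    -- The first-order part is annihilated by v; only the Taylor error of c and the variation of its
    -- derivative remain.
    have h0 : inner ℝ v (A (x - xbar + d)) = 0 := by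
      rw [← ContinuousLinearMap.adjoint_inner_left, hv, inner_zero_left]
    rw [e, inner_add_right, h0, add_zero]
    refine (abs_real_inner_le_norm _ _).trans ?_
    have h1 := norm_add_le (c x - c xbar - A (x - xbar)) ((fderiv ℝ c x - A) d)
    have h2 := ((fderiv ℝ c x - A).le_opNorm d).trans
      (mul_le_mul_of_nonneg_right hl (norm_nonneg d))
    have h3 : ‖(c x - c xbar - A (x - xbar)) + (fderiv ℝ c x - A) d‖ ≤ Q * (s ^ 2 + s * ‖d‖) := by
      linarith
    have h4 := mul_le_mul_of_nonneg_left h3 (norm_nonneg v)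
    have h5 : 0 ≤ (Q + ‖A‖) * (s ^ 2 + s * ‖d‖) := by positivity
    linarith

/-- If D exceeded the bound, then s ≤ D, every s² could be replaced by sD, and division by θD would
contradict this. The κ² term carries the same factor θ as D², so the constant does not depend on θ,
hence not on μ. -/
theorem le_mul_of_quadratic_bound {D s θ ε P C κ : ℝ} (hD : 0 ≤ D) (hs : 0 ≤ s) (hε : 0 < ε)
    (hP : 0 ≤ P) (hC : 0 ≤ C) (hθ : ε / 2 ≤ θ)
    (h : θ * D ^ 2 ≤ P * s ^ 2 + C * (s * D) + θ * (κ ^ 2 * s ^ 2)) :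
    D ≤ (2 * (P + C) / ε + κ ^ 2 + 1) * s := by
  by_contra! hlt
  have hθ0 : 0 < θ := by linarith
  set T := 2 * (P + C) / ε with hT
  have hT0 : 0 ≤ T := by positivity
  have hsD : s ≤ D := by nlinarith [sq_nonneg κ, mul_nonneg hT0 hs, mul_nonneg (sq_nonneg κ) hs]
  have hss : s ^ 2 ≤ s * D := by nlinarith
  have hPC : P + C ≤ θ * T := by
    have : P + C = ε / 2 * T := by rw [hT]; field_simp
    rw [this]
    exact mul_le_mul_of_nonneg_right hθ hT0
  have hsD0 : 0 ≤ s * D := mul_nonneg hs hD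
  have h1 : θ * D ^ 2 ≤ θ * ((T + κ ^ 2) * (s * D)) := by
    have a1 := mul_le_mul_of_nonneg_left hss hP
    have a2 := mul_le_mul_of_nonneg_left hss (mul_nonneg hθ0.le (sq_nonneg κ))
    have a3 := mul_le_mul_of_nonneg_right hPC hsD0
    linarith
  have h2 := le_of_mul_le_mul_left h1 hθ0
  have hDpos : 0 < D := lt_of_le_of_lt (by positivity) hlt
  have h3 : D ≤ (T + κ ^ 2) * s := by
    refine le_of_mul_le_mul_right ?_ hDpos
    linarith
  linarith

/-- Subtracting the two bounds on b leaves D² with coefficient θ = μ/2 - ρK² ≥ ε/2. Writing μ/2 = θ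
+ ρK² on the right produces the last term of `P`. The constant is fixed before μ, which may tend to
infinity. -/
theorem exists_small_step_bounds {C κ K ρ T ε : ℝ} (hC : 0 ≤ C) (hρ : 0 ≤ ρ)
    (hT : 0 ≤ T) (hε : 0 < ε) :
    ∃ C' : ℝ, 0 ≤ C' ∧ ∀ {s D b h₀ μ : ℝ}, 0 ≤ s → 0 ≤ D →
      h₀ - C * (s ^ 2 + s * D) - ρ * C ^ 2 * s ^ 2 - ρ * K ^ 2 * D ^ 2 ≤ b →
      b + μ / 2 * D ^ 2 ≤ h₀ + T * s ^ 2 + μ / 2 * (κ ^ 2 * s ^ 2) →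
      2 * ρ * K ^ 2 + ε ≤ μ →
      D ≤ C' * s ∧ |b - h₀| ≤ C' * (s ^ 2 + μ * s ^ 2) := by
  obtain ⟨P, hP⟩ : ∃ P, P = T + C + ρ * C ^ 2 + ρ * K ^ 2 * κ ^ 2 := ⟨_, rfl⟩
  have hP0 : 0 ≤ P := by rw [hP]; positivity
  obtain ⟨B, hB⟩ : ∃ B, B = 2 * (P + C) / ε + κ ^ 2 + 1 := ⟨_, rfl⟩
  have hB0 : 0 ≤ B := by rw [hB]; positivity
  obtain ⟨S, hS⟩ : ∃ S, S = C + C * B + ρ * C ^ 2 + ρ * K ^ 2 * B ^ 2 := ⟨_, rfl⟩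
  have hS0 : 0 ≤ S := by rw [hS]; positivity
  have hρK : 0 ≤ ρ * K ^ 2 := by positivity
  refine ⟨B + T + κ ^ 2 + S, by positivity, fun {s D b h₀ μ} hs hD hlo hup hμ => ?_⟩
  have hμ0 : 0 ≤ μ := by linarith
  have hDle : D ≤ B * s := by
    rw [hB]
    refine le_mul_of_quadratic_bound (θ := μ / 2 - ρ * K ^ 2) hD hs hε hP0 hC (by linarith) ?_
    rw [hP]
    linarith
  refine ⟨hDle.trans (mul_le_mul_of_nonneg_right (by linarith [sq_nonneg κ]) hs), ?_⟩
  have hlow' : h₀ - S * s ^ 2 ≤ b := by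
    have hD2 : D ^ 2 ≤ B ^ 2 * s ^ 2 := by rw [← mul_pow]; gcongr
    have b1 := mul_le_mul_of_nonneg_left hD2 hρK
    have b2 := mul_le_mul_of_nonneg_left (mul_le_mul_of_nonneg_left hDle hs) hC
    rw [hS]; linarith
  have hμs : 0 ≤ μ * s ^ 2 := by positivity
  have hupp : b ≤ h₀ + T * s ^ 2 + κ ^ 2 * (μ * s ^ 2) := by
    have h1 : 0 ≤ μ / 2 * D ^ 2 := by positivity
    have h2 : 0 ≤ κ ^ 2 * (μ * s ^ 2) := by positivity
    linarith
  have hsum : S * s ^ 2 ≤ (B + T + κ ^ 2 + S) * (s ^ 2 + μ * s ^ 2) := by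
    gcongr
    · linarith [sq_nonneg κ]
    · linarith
  have hsum' : T * s ^ 2 + κ ^ 2 * (μ * s ^ 2) ≤ (B + T + κ ^ 2 + S) * (s ^ 2 + μ * s ^ 2) := by
    rw [mul_add]
    gcongr
    · linarith [sq_nonneg κ]
    · linarith
  rw [abs_le]
  constructor <;> linarith

/-- Existence of small local minimizers of the proximal linearized subproblems. -/
theorem exists_small_local_min (hc : ContDiffAt ℝ 2 c xbar) {v : EuclideanSpace ℝ (Fin m)}
    (hv : ContinuousLinearMap.adjoint (fderiv ℝ c xbar) v = 0) {ρ h₀ : ℝ} (hρ : 0 ≤ ρ)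
    (hlsc : ∀ᶠ z in 𝓝 (c xbar), LowerSemicontinuousAt h z)
    (hlow : ∀ᶠ z in 𝓝 (c xbar),
      ((h₀ + inner ℝ v (z - c xbar) - ρ / 2 * ‖z - c xbar‖ ^ 2 : ℝ) : EReal) ≤ h z)
    {C₂ : ℝ} (hC₂ : 0 ≤ C₂) (hup : ∀ᶠ z in 𝓝 (c xbar), z ∈ M →
      h z ≤ ((h₀ + inner ℝ v (z - c xbar) + C₂ * ‖z - c xbar‖ ^ 2 : ℝ) : EReal))
    {κ : ℝ} (hκ : 0 ≤ κ)
    (hfeas : ∀ᶠ x in 𝓝 xbar, ∃ d, pred c x d ∈ M ∧ ‖d‖ ≤ κ * ‖x - xbar‖)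
    {ε : ℝ} (hε : 0 < ε) :
    ∃ C : ℝ, 0 ≤ C ∧ ∀ᶠ x in 𝓝 xbar, ∀ μ : ℝ,
      2 * ρ * (‖fderiv ℝ c xbar‖ + 1) ^ 2 + ε ≤ μ → ∃ (d : EuclideanSpace ℝ (Fin n)) (b : ℝ),
        ‖d‖ ≤ C * ‖x - xbar‖ ∧ IsLocalMin (proxObjective h c x μ) d ∧ h (pred c x d) = b ∧
        |b - h₀| ≤ C * (‖x - xbar‖ ^ 2 + μ * ‖x - xbar‖ ^ 2) := by
  obtain ⟨C, hC, hest⟩ := exists_pred_estimates hc hv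
  set K := ‖fderiv ℝ c xbar‖ + 1 with hK
  have hKpos : 0 < K := by positivity
  obtain ⟨δ, hδ, hball⟩ := Metric.mem_nhds_iff.1 (hlsc.and (hlow.and hup))
  -- Predictions from steps of norm at most R move at most δ/4 + δ/4 from c̄, whatever μ is.
  set R := δ / (4 * K) with hR
  have hRpos : 0 < R := by positivity
  have hKR : K * R = δ / 4 := by rw [hR]; field_simp
  -- Second-order excess of h over h₀ at the feasible comparison step d₀, for which ‖d₀‖ ≤ κs.
  set T := C * (1 + κ) + C₂ * (C + K * κ) ^ 2 with hT
  have hT0 : 0 ≤ T := by positivity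
  obtain ⟨C', hC'0, hbounds⟩ := exists_small_step_bounds (κ := κ) (T := T) hC (ρ := ρ)
    (K := K) hρ hT0 hε
  refine ⟨C', hC'0, ?_⟩
  have hcont : ∀ B : ℝ, ∀ η : ℝ, 0 < η → ∀ᶠ x in 𝓝 xbar, B * ‖x - xbar‖ < η := fun B η hη => by
    have : Continuous fun x : EuclideanSpace ℝ (Fin n) => B * ‖x - xbar‖ := by fun_prop
    exact (this.tendsto xbar).eventually_lt_const (by simpa using hη)
  filter_upwards [hest, hfeas, hcont C (δ / 4) (by positivity), hcont κ R hRpos,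
    hcont C' R hRpos] with x ⟨hxn, hxd⟩ ⟨d₀, hd₀M, hd₀⟩ hs1 hs2 hs3 μ hμ
  set s := ‖x - xbar‖ with hs
  have hs0 : 0 ≤ s := norm_nonneg _
  have hρK : 0 ≤ ρ * K ^ 2 := by positivity
  have hμ0 : 0 ≤ μ := by linarith
  have hgood : ∀ d, ‖d‖ ≤ R → pred c x d ∈ Metric.ball (c xbar) δ := fun d hd => by
    rw [Metric.mem_ball, dist_eq_norm]
    have h1 := (hxd d).1
    have h2 := mul_le_mul_of_nonneg_left hd hKpos.le
    linarith
  have hex : ∃ d ∈ Metric.closedBall (0 : EuclideanSpace ℝ (Fin n)) R,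
      IsMinOn (proxObjective h c x μ) (Metric.closedBall 0 R) d := by
    refine LowerSemicontinuousOn.exists_isMinOn ⟨0, by simp [hRpos.le]⟩
      (isCompact_closedBall _ _) fun d hd => ?_
    refine LowerSemicontinuousAt.lowerSemicontinuousWithinAt _ ?_
    have h1 := (hball (hgood d (by simpa using hd))).1
    exact lowerSemicontinuousAt_add_coe (h1.comp (continuous_pred x).continuousAt)
      (r := fun d : EuclideanSpace ℝ (Fin n) => μ / 2 * ‖d‖ ^ 2)
      (by fun_prop)
  obtain ⟨d, hdR, hmin⟩ := hex
  rw [mem_closedBall_zero_iff] at hdR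
  have hd₀R : ‖d₀‖ ≤ R := hd₀.trans hs2.le
  have hd₀val : h (pred c x d₀) ≤ ((h₀ + T * s ^ 2 : ℝ) : EReal) := by
    refine ((hball (hgood d₀ hd₀R)).2.2 hd₀M).trans ?_
    rw [EReal.coe_le_coe_iff]
    obtain ⟨a1, a2⟩ := hxd d₀
    have a3 := (abs_le.1 a2).2
    have a4 : ‖pred c x d₀ - c xbar‖ ≤ (C + K * κ) * s := by
      have := mul_le_mul_of_nonneg_left hd₀ hKpos.le
      linarith
    have a5 : ‖pred c x d₀ - c xbar‖ ^ 2 ≤ ((C + K * κ) * s) ^ 2 := by gcongr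
    have a6 := mul_le_mul_of_nonneg_left a5 hC₂
    have a7 := mul_le_mul_of_nonneg_left (mul_le_mul_of_nonneg_left hd₀ hs0) hC
    rw [hT]
    linarith
  have hdval : h (pred c x d) + ((μ / 2 * ‖d‖ ^ 2 : ℝ) : EReal) ≤
      ((h₀ + T * s ^ 2 + μ / 2 * (κ ^ 2 * s ^ 2) : ℝ) : EReal) := by
    have h1 : proxObjective h c x μ d ≤ proxObjective h c x μ d₀ := hmin (by simpa using hd₀R)
    refine h1.trans ?_
    have h2 : ‖d₀‖ ^ 2 ≤ κ ^ 2 * s ^ 2 := by rw [← mul_pow]; gcongr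
    have h3 := mul_le_mul_of_nonneg_left h2 (show 0 ≤ μ / 2 by positivity)
    rw [EReal.coe_add]
    exact add_le_add hd₀val (EReal.coe_le_coe_iff.2 h3)
  have hlowd := (hball (hgood d hdR)).2.1
  have hfin : FiniteAt h (pred c x d) := by
    rw [add_coe_le_coe_iff] at hdval
    exact ⟨ne_top_of_le_ne_top (EReal.coe_ne_top _) hdval,
      ne_bot_of_le_ne_bot (EReal.coe_ne_bot _) hlowd⟩
  obtain ⟨b, hb⟩ := hfin.exists_real
  rw [hb, ← EReal.coe_add, EReal.coe_le_coe_iff] at hdval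
  rw [hb, EReal.coe_le_coe_iff] at hlowd
  set D := ‖d‖ with hD
  have hD0 : 0 ≤ D := norm_nonneg _
  have hblow : h₀ - C * (s ^ 2 + s * D) - ρ * C ^ 2 * s ^ 2 - ρ * K ^ 2 * D ^ 2 ≤ b := by
    obtain ⟨a1, a2⟩ := hxd d
    have a3 := (abs_le.1 a2).1
    have a4 : ‖pred c x d - c xbar‖ ^ 2 ≤ 2 * (C ^ 2 * s ^ 2) + 2 * (K ^ 2 * D ^ 2) := by
      have : ‖pred c x d - c xbar‖ ^ 2 ≤ (C * s + K * D) ^ 2 := by gcongr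
      nlinarith [sq_nonneg (C * s - K * D)]
    have a5 := mul_le_mul_of_nonneg_left a4 (show 0 ≤ ρ / 2 by positivity)
    linarith
  obtain ⟨hDle, hb_bound⟩ := hbounds hs0 hD0 hblow hdval hμ
  refine ⟨d, b, hDle, ?_, hb, hb_bound⟩
  refine hmin.isLocalMin (mem_of_superset (Metric.isOpen_ball.mem_nhds ?_)
    Metric.ball_subset_closedBall)
  rw [mem_ball_zero_iff]
  exact hDle.trans_lt hs3

theorem zero_mem_subdifferential_of_isLocalMin {X : Type*} [NormedAddCommGroup X]
    [InnerProductSpace ℝ X] {f : X → EReal} {d : X} (hfin : FiniteAt f d) (hd : IsLocalMin f d) :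
    (0 : X) ∈ subdifferential f d := by
  refine regularSubdifferential_subset_subdifferential f d ⟨hfin, fun ε hε => ?_⟩
  obtain ⟨a, ha⟩ := hfin.exists_real
  filter_upwards [hd] with z hz
  refine le_trans ?_ hz
  rw [ha]
  norm_cast
  rw [inner_zero_left]
  have : 0 ≤ ε * ‖z - d‖ := by positivity
  linarith

end Subproblems

/-! ### Minimality, uniqueness and existence of small critical sequences -/

section CriticalSequences

variable {n m : ℕ} {h : EuclideanSpace ℝ (Fin m) → EReal}
  {c : EuclideanSpace ℝ (Fin n) → EuclideanSpace ℝ (Fin m)}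
  {xbar : EuclideanSpace ℝ (Fin n)} {M : Set (EuclideanSpace ℝ (Fin m))}
  {μ : ℕ → ℝ} {x d : ℕ → EuclideanSpace ℝ (Fin n)}

theorem LocalProxInequality.eventually_le {Y : Type*} [NormedAddCommGroup Y]
    [InnerProductSpace ℝ Y] {h : Y → EReal} {y v : Y} {ρ h₀ : ℝ}
    (hp : LocalProxInequality h y v ρ) (hv : v ∈ subdifferential h y) (h0 : h y = h₀) :
    ∀ᶠ z in 𝓝 y, ((h₀ + inner ℝ v (z - y) - ρ / 2 * ‖z - y‖ ^ 2 : ℝ) : EReal) ≤ h z := by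
  obtain ⟨δ, hδ, U, hU, hineq⟩ := hp
  filter_upwards [Metric.ball_mem_nhds y hδ] with z hz
  rw [Metric.mem_ball, dist_eq_norm] at hz
  have := hineq y z v (by simpa using hδ) hz (mem_of_mem_nhds hU) hv (by simpa using hδ)
  rwa [h0, ← EReal.coe_add, ← add_sub_assoc] at this

theorem IsSmallCriticalSeq.tendsto_zero (hd : IsSmallCriticalSeq h c xbar μ x d)
    (hx : Tendsto x atTop (𝓝 xbar)) : Tendsto d atTop (𝓝 0) :=
  hd.2.1.trans_tendsto (by simpa using hx.sub_const xbar)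

theorem IsSmallCriticalSeq.tendsto_pred (hc : ContDiffAt ℝ 2 c xbar)
    (hd : IsSmallCriticalSeq h c xbar μ x d) (hx : Tendsto x atTop (𝓝 xbar)) :
    Tendsto (fun r => pred c (x r) (d r)) atTop (𝓝 (c xbar)) :=
  (ProxLinear.tendsto_pred hc).comp (hx.prodMk_nhds (hd.tendsto_zero hx))

/-- Small critical sequences eventually have multipliers arbitrarily close to `vbar`. -/
theorem IsSmallCriticalSeq.eventually_exists_multiplier {vbar : EuclideanSpace ℝ (Fin m)}
    (hc : ContDiffAt ℝ 2 c xbar) (hreg : SubdifferentiallyRegularAt h (c xbar))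
    (hvbar : vbar ∈ subdifferential h (c xbar)) (hA : vbar ∈ nullAdjoint c xbar)
    (hcq : (affineSpan ℝ (subdifferential h (c xbar))).direction ⊓ nullAdjoint c xbar = ⊥)
    (hlsc : ∀ᶠ z in 𝓝 (c xbar), LowerSemicontinuousAt h z)
    (hbot : ∀ᶠ z in 𝓝 (c xbar), h z ≠ ⊥)
    (hd : IsSmallCriticalSeq h c xbar μ x d) (hx : Tendsto x atTop (𝓝 xbar))
    (hμx : Tendsto (fun r => μ r * ‖x r - xbar‖) atTop (𝓝 0)) {ε : ℝ} (hε : 0 < ε) :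
    ∀ᶠ r in atTop, ∃ v ∈ subdifferential h (pred c (x r) (d r)),
      ContinuousLinearMap.adjoint (fderiv ℝ c (x r)) v = -(μ r • d r) ∧ ‖v - vbar‖ ≤ ε := by
  have hev := ProxLinear.eventually_exists_multiplier (A := fderiv ℝ c xbar) hreg hvbar hA hcq
    hlsc hbot hε
  have hL : Tendsto (fun r => fderiv ℝ c (x r)) atTop (𝓝 (fderiv ℝ c xbar)) :=
    ((hc.fderiv_right (m := 1) (by norm_num)).continuousAt.tendsto).comp hx
  have hμd : Tendsto (fun r => -(μ r • d r)) atTop (𝓝 0) := by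
    have h1 : (fun r => μ r • d r) =O[atTop] fun r => μ r * ‖x r - xbar‖ := by
      have := (isBigO_refl μ atTop).smul hd.2.1.norm_right
      simpa only [smul_eq_mul] using this
    simpa using (h1.trans_tendsto hμx).neg
  have hT : Tendsto (fun r => ((pred c (x r) (d r), h (pred c (x r) (d r))),
      (fderiv ℝ c (x r), -(μ r • d r)))) atTop
      (𝓝 ((c xbar, h (c xbar)), (fderiv ℝ c xbar, 0))) :=
    ((hd.tendsto_pred hc hx).prodMk_nhds hd.2.2).prodMk_nhds (hL.prodMk_nhds hμd)
  filter_upwards [hT.eventually hev, hd.1] with r hr hcrit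
  exact hr (c (x r)) (μ r) (d r) rfl rfl rfl hcrit

/-- A critical point with a multiplier satisfying the local subgradient inequality is a local
minimizer once the proximal parameter dominates the curvature. -/
theorem isLocalMin_of_multiplier {x d : EuclideanSpace ℝ (Fin n)}
    {v : EuclideanSpace ℝ (Fin m)} {μ ρ K : ℝ} (hρ : 0 ≤ ρ)
    (hfin : FiniteAt h (pred c x d)) (hK : ‖fderiv ℝ c x‖ ≤ K)
    (hv : ContinuousLinearMap.adjoint (fderiv ℝ c x) v = -(μ • d)) (hμ : ρ * K ^ 2 ≤ μ)
    (hineq : ∀ᶠ z in 𝓝 (pred c x d), h (pred c x d) +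
      ((inner ℝ v (z - pred c x d) - ρ / 2 * ‖z - pred c x d‖ ^ 2 : ℝ) : EReal) ≤ h z) :
    IsLocalMin (proxObjective h c x μ) d := by
  obtain ⟨a, ha⟩ := hfin.exists_real
  filter_upwards [(continuous_pred x).continuousAt.eventually hineq] with d' hd'
  have e : pred c x d' - pred c x d = fderiv ℝ c x (d' - d) := by
    simp only [pred, map_sub]; abel
  rw [e, ← ContinuousLinearMap.adjoint_inner_left, hv, ha, ← EReal.coe_add] at hd'
  simp only [proxObjective]
  rw [ha, ← EReal.coe_add, coe_le_add_coe_iff]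
  refine le_trans ?_ hd'
  rw [EReal.coe_le_coe_iff]
  -- The linear term cancels against the multiplier equation, leaving μ/2‖d' - d‖² to absorb the
  -- curvature loss ρK²/2‖d' - d‖².
  have e1 : ‖d'‖ ^ 2 = ‖d‖ ^ 2 + 2 * inner ℝ d (d' - d) + ‖d' - d‖ ^ 2 := by
    rw [← norm_add_sq_real]; simp
  have e2 : ‖fderiv ℝ c x (d' - d)‖ ^ 2 ≤ K ^ 2 * ‖d' - d‖ ^ 2 := by
    rw [← mul_pow]
    gcongr
    exact ((fderiv ℝ c x).le_opNorm _).trans (mul_le_mul_of_nonneg_right hK (norm_nonneg _))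
  have e3 := mul_le_mul_of_nonneg_left e2 hρ
  have e4 := mul_le_mul_of_nonneg_right hμ (sq_nonneg ‖d' - d‖)
  rw [e1, inner_neg_left, inner_smul_left]
  simp only [conj_trivial]
  linarith

/-- Critical points with hypomonotone multipliers coincide. -/
theorem eq_of_multipliers {x d d' : EuclideanSpace ℝ (Fin n)}
    {v v' : EuclideanSpace ℝ (Fin m)} {μ ρ K : ℝ} (hρ : 0 ≤ ρ) (hK : ‖fderiv ℝ c x‖ ≤ K)
    (hv : ContinuousLinearMap.adjoint (fderiv ℝ c x) v = -(μ • d))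
    (hv' : ContinuousLinearMap.adjoint (fderiv ℝ c x) v' = -(μ • d')) (hμ : ρ * K ^ 2 < μ)
    (hmono : inner ℝ (v' - v) (pred c x d - pred c x d') ≤
      ρ * ‖pred c x d - pred c x d'‖ ^ 2) : d' = d := by
  have e : pred c x d - pred c x d' = fderiv ℝ c x (d - d') := by
    simp only [pred, map_sub]; abel
  rw [e, ← ContinuousLinearMap.adjoint_inner_left, map_sub, hv, hv'] at hmono
  -- Hypomonotonicity thus reads μ‖d - d'‖² ≤ ρ‖∇c(x)(d - d')‖², impossible for d ≠ d' when μ > ρK².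
  have e0 : -(μ • d') - -(μ • d) = μ • (d - d') := by rw [smul_sub]; abel
  rw [e0, inner_smul_left, real_inner_self_eq_norm_sq] at hmono
  simp only [conj_trivial] at hmono
  have e2 : ‖fderiv ℝ c x (d - d')‖ ^ 2 ≤ K ^ 2 * ‖d - d'‖ ^ 2 := by
    rw [← mul_pow]
    gcongr
    exact ((fderiv ℝ c x).le_opNorm _).trans (mul_le_mul_of_nonneg_right hK (norm_nonneg _))
  have e3 := mul_le_mul_of_nonneg_left e2 hρ
  have h4 : ‖d - d'‖ ^ 2 ≤ 0 := by
    by_contra! hpos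
    have := mul_lt_mul_of_pos_right hμ hpos
    linarith
  have h5 : ‖d - d'‖ = 0 := pow_eq_zero_iff (two_ne_zero) |>.1 (le_antisymm h4 (sq_nonneg _))
  exact (sub_eq_zero.1 (norm_eq_zero.1 h5)).symm

/-- Small critical sequences consist of local minimizers, are unique, identify the manifold and
can be corrected, when the proximal parameters dominate the curvature. -/
theorem exists_constant_small_critical_seq {vbar : EuclideanSpace ℝ (Fin m)} {ρ : ℝ}
    (hc : ContDiffAt ℝ 2 c xbar) (hps : PartlySmoothAt h M (c xbar))
    (hcq : (affineSpan ℝ (subdifferential h (c xbar))).direction ⊓ nullAdjoint c xbar = ⊥)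
    (hvbar : vbar ∈ intrinsicInterior ℝ (subdifferential h (c xbar)))
    (hA : vbar ∈ nullAdjoint c xbar)
    (hlsc : ∀ᶠ z in 𝓝 (c xbar), LowerSemicontinuousAt h z) (hρ : 0 ≤ ρ)
    (hprox : LocalProxInequality h (c xbar) vbar ρ) :
    ∃ γ : ℝ, 0 ≤ γ ∧ ∀ (μ : ℕ → ℝ) (x : ℕ → EuclideanSpace ℝ (Fin n)),
      (∀ r, ρ * (‖fderiv ℝ c xbar‖ + 1) ^ 2 < μ r) → Tendsto x atTop (𝓝 xbar) →
      Tendsto (fun r => μ r * ‖x r - xbar‖) atTop (𝓝 0) →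
      ∀ d : ℕ → EuclideanSpace ℝ (Fin n), IsSmallCriticalSeq h c xbar μ x d →
        (∀ᶠ r in atTop, IsLocalMin (proxObjective h c (x r) (μ r)) (d r)) ∧
        (∀ d' : ℕ → EuclideanSpace ℝ (Fin n),
          IsSmallCriticalSeq h c xbar μ x d' → ∀ᶠ r in atTop, d' r = d r) ∧
        ∀ᶠ r in atTop, IdentifiesAndCorrects h c M γ (x r) (d r) := by
  obtain ⟨k, F, hF, ⟨g, hgC, hg⟩, hreg, hpar, hcont⟩ := hps
  have hvmem := intrinsicInterior_subset hvbar
  have hregc := (hreg.self_of_nhdsWithin hF.1).1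
  have hgc : h (c xbar) = (g (c xbar) : EReal) := hg.self_of_nhdsWithin hF.1
  have hbot : ∀ᶠ z in 𝓝 (c xbar), h z ≠ ⊥ :=
    (hprox.eventually_le hvmem hgc).mono fun z hz =>
      ne_bot_of_le_ne_bot (EReal.coe_ne_bot _) hz
  have htrans := surjective_fderiv_comp hF.2.2.1 (by rw [← hpar]; exact hcq)
  obtain ⟨γ, hγ, hcorr⟩ := exists_correction_constant hc hF hgC hg htrans
  have hident := eventually_mem_manifold hF hgC.continuousAt hg hpar hcont.2 hprox hvbar
  rw [nhds_prod_eq, eventually_prod_iff] at hident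
  obtain ⟨pa, hpa, pb, hpb, hident⟩ := hident
  obtain ⟨δ₁, hδ₁, hball₁⟩ := Metric.eventually_nhds_iff.1 hpb
  obtain ⟨δ, hδ, U, hU, hineq⟩ := hprox
  obtain ⟨ε, hε, hεδ, hεδ₁⟩ : ∃ ε : ℝ, 0 < ε ∧ ε < δ ∧ ε < δ₁ :=
    ⟨min δ δ₁ / 2, by positivity, by linarith [min_le_left δ δ₁, lt_min hδ hδ₁],
      by linarith [min_le_right δ δ₁, lt_min hδ hδ₁]⟩
  refine ⟨γ, hγ, fun μ x hμ hx hμx d hd => ?_⟩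
  have hK : ∀ᶠ r in atTop, ‖fderiv ℝ c (x r)‖ ≤ ‖fderiv ℝ c xbar‖ + 1 := by
    have hL : Tendsto (fun r => ‖fderiv ℝ c (x r)‖) atTop (𝓝 ‖fderiv ℝ c xbar‖) :=
      (((hc.fderiv_right (m := 1) (by norm_num)).continuousAt.tendsto).comp hx).norm
    exact (hL.eventually_lt_const (lt_add_one _)).mono fun _ hr => hr.le
  have hbasic : ∀ d, IsSmallCriticalSeq h c xbar μ x d → ∀ᶠ r in atTop,
      ‖pred c (x r) (d r) - c xbar‖ < δ ∧ h (pred c (x r) (d r)) ∈ U ∧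
      ∃ v ∈ subdifferential h (pred c (x r) (d r)),
      ContinuousLinearMap.adjoint (fderiv ℝ c (x r)) v = -(μ r • d r) ∧ ‖v - vbar‖ ≤ ε := by
    intro d hd
    filter_upwards [(tendsto_iff_norm_sub_tendsto_zero.1
      (hd.tendsto_pred hc hx)).eventually_lt_const hδ, hd.2.2.eventually_mem hU,
      hd.eventually_exists_multiplier hc hregc hvmem hA hcq hlsc hbot hx hμx hε]
      with r h1 h2 h3 using ⟨h1, h2, h3⟩
  refine ⟨?_, fun d' hd' => ?_, ?_⟩
  · filter_upwards [hbasic d hd, hK] with r ⟨h1, h2, v, hv, hAv, hvε⟩ hKr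
    refine isLocalMin_of_multiplier hρ hv.1 hKr hAv (hμ r).le ?_
    have : ∀ᶠ z in 𝓝 (pred c (x r) (d r)), ‖z - c xbar‖ < δ := by
      have : Continuous fun z : EuclideanSpace ℝ (Fin m) => ‖z - c xbar‖ := by fun_prop
      exact this.continuousAt.eventually_lt_const h1
    filter_upwards [this] with z hz using hineq _ z v h1 hz h2 hv (hvε.trans_lt hεδ)
  · filter_upwards [hbasic d hd, hbasic d' hd', hK] with r ⟨h1, h2, v, hv, hAv, hvε⟩
      ⟨h1', h2', v', hv', hAv', hvε'⟩ hKr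
    exact eq_of_multipliers hρ hKr hAv hAv' (hμ r) (inner_sub_le_of_prox hv'.1 hv.1
      (hineq _ _ v' h1' h1 h2' hv' (hvε'.trans_lt hεδ))
      (hineq _ _ v h1 h1' h2 hv (hvε.trans_lt hεδ)))
  · have hq : Tendsto (fun r => (pred c (x r) (d r), h (pred c (x r) (d r)))) atTop
        (𝓝 (c xbar, h (c xbar))) := (hd.tendsto_pred hc hx).prodMk_nhds hd.2.2
    filter_upwards [hbasic d hd, hq.eventually hpa,
      (hx.prodMk_nhds (hd.tendsto_zero hx)).eventually hcorr]
      with r ⟨_, _, v, hv, _, hvε⟩ h3 h4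
    exact h4 (hident h3 (hball₁ (by rw [dist_eq_norm]; exact hvε.trans_lt hεδ₁)) hv rfl)

/-- Existence of small critical sequences, when the proximal parameters are uniformly larger than
a multiple of the curvature. -/
theorem exists_small_critical_seq {vbar : EuclideanSpace ℝ (Fin m)} {ρ : ℝ}
    (hc : ContDiffAt ℝ 2 c xbar) (hps : PartlySmoothAt h M (c xbar))
    (hcq : (affineSpan ℝ (subdifferential h (c xbar))).direction ⊓ nullAdjoint c xbar = ⊥)
    (hvmem : vbar ∈ subdifferential h (c xbar)) (hA : vbar ∈ nullAdjoint c xbar)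
    (hlsc : ∀ᶠ z in 𝓝 (c xbar), LowerSemicontinuousAt h z) (hρ : 0 ≤ ρ)
    (hprox : LocalProxInequality h (c xbar) vbar ρ) {ε : ℝ} (hε : 0 < ε)
    (hμ : ∀ r, 2 * ρ * (‖fderiv ℝ c xbar‖ + 1) ^ 2 + ε ≤ μ r) (hx : Tendsto x atTop (𝓝 xbar))
    (hμx : Tendsto (fun r => μ r * ‖x r - xbar‖) atTop (𝓝 0)) :
    ∃ d : ℕ → EuclideanSpace ℝ (Fin n), IsSmallCriticalSeq h c xbar μ x d := by
  obtain ⟨k, F, hF, ⟨g, hgC, hg⟩, hreg, hpar, hcont⟩ := hps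
  have hgc : h (c xbar) = (g (c xbar) : EReal) := hg.self_of_nhdsWithin hF.1
  have htrans := surjective_fderiv_comp hF.2.2.1 (by rw [← hpar]; exact hcq)
  have hlow := hprox.eventually_le hvmem hgc
  obtain ⟨C₂, hC₂, hup⟩ := exists_quadratic_upper_bound hF hgC hg hlow
  obtain ⟨κ, hκ, hfeas⟩ := exists_feasible_step hc hF htrans
  obtain ⟨C, hC, hev⟩ := exists_small_local_min hc hA hρ hlsc hlow hC₂ hup hκ hfeas hε
  obtain ⟨d, hd⟩ := ((hx.eventually hev).mono fun r hr => hr (μ r) (hμ r)).choice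
  obtain ⟨b, hb⟩ := hd.choice
  refine ⟨d, ?_, IsBigO.of_bound C (hb.mono fun r hr => hr.1), ?_⟩
  · filter_upwards [hb] with r ⟨_, hmin, hbr, _⟩
    refine zero_mem_subdifferential_of_isLocalMin ?_ hmin
    exact finiteAt_of_eq_coe (a := b r + μ r / 2 * ‖d r‖ ^ 2) (by
      rw [proxObjective, hbr, ← EReal.coe_add])
  · rw [hgc]
    have hs : Tendsto (fun r => ‖x r - xbar‖) atTop (𝓝 0) :=
      tendsto_iff_norm_sub_tendsto_zero.1 hx
    -- The term μ|x - x̄|² is the product of μ|x - x̄| and |x - x̄|, both tending to 0.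
    have hbound : Tendsto (fun r => C * (‖x r - xbar‖ ^ 2 + μ r * ‖x r - xbar‖ ^ 2)) atTop
        (𝓝 0) := by
      have h1 := ((hs.mul hs).add (hμx.mul hs)).const_mul C
      simp only [mul_zero, add_zero] at h1
      refine h1.congr fun r => ?_
      ring
    have hblim : Tendsto b atTop (𝓝 (g (c xbar))) :=
      tendsto_iff_norm_sub_tendsto_zero.2 (squeeze_zero'
        (Eventually.of_forall fun _ => norm_nonneg _) (hb.mono fun r hr => hr.2.2.2) hbound)
    refine ((continuous_coe_real_ereal.tendsto _).comp hblim).congr' ?_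
    filter_upwards [hb] with r hr using hr.2.2.1.symm

end CriticalSequences

end ProxLinear

/-! ### Assembly of the two parts of the theorem -/

theorem mainTheorem3 (n m : ℕ)
    (h : EuclideanSpace ℝ (Fin m) → EReal)
    (c : EuclideanSpace ℝ (Fin n) → EuclideanSpace ℝ (Fin m))
    (xbar : EuclideanSpace ℝ (Fin n)) (M : Set (EuclideanSpace ℝ (Fin m)))
    (hc : ContDiffAt ℝ 2 c xbar)
    (hprox : ProxLinear.ProxRegularAt h (c xbar))
    (hps : ProxLinear.PartlySmoothAt h M (c xbar))
    (hcq : (affineSpan ℝ (ProxLinear.subdifferential h (c xbar))).direction ⊓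
      ProxLinear.nullAdjoint c xbar = ⊥)
    (hstrict : (intrinsicInterior ℝ (ProxLinear.subdifferential h (c xbar)) ∩
      (ProxLinear.nullAdjoint c xbar : Set (EuclideanSpace ℝ (Fin m)))).Nonempty) :
    (∃ μhat : ℝ, 0 ≤ μhat ∧ ∃ γ : ℝ, 0 ≤ γ ∧
      ∀ (μ : ℕ → ℝ) (x : ℕ → EuclideanSpace ℝ (Fin n)),
        (∀ r, μhat < μ r) → Tendsto x atTop (𝓝 xbar) →
        Tendsto (fun r => μ r * ‖x r - xbar‖) atTop (𝓝 0) →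
        ∃ d : ℕ → EuclideanSpace ℝ (Fin n),
          (∀ᶠ r in atTop, IsLocalMin (ProxLinear.proxObjective h c (x r) (μ r)) (d r)) ∧
          ProxLinear.IsSmallCriticalSeq h c xbar μ x d ∧
          (∀ d' : ℕ → EuclideanSpace ℝ (Fin n),
            ProxLinear.IsSmallCriticalSeq h c xbar μ x d' → ∀ᶠ r in atTop, d' r = d r) ∧
          ∀ᶠ r in atTop, ProxLinear.IdentifiesAndCorrects h c M γ (x r) (d r)) ∧
    (ProxLinear.ConvexLsc h → ∃ γ : ℝ, 0 ≤ γ ∧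
      ∀ (μ : ℕ → ℝ) (x : ℕ → EuclideanSpace ℝ (Fin n)),
        (∀ r, 0 < μ r) → Tendsto x atTop (𝓝 xbar) →
        Tendsto (fun r => μ r * ‖x r - xbar‖) atTop (𝓝 0) →
        ((∃ ε : ℝ, 0 < ε ∧ ∀ r, ε ≤ μ r) →
          ∃ d : ℕ → EuclideanSpace ℝ (Fin n), ProxLinear.IsSmallCriticalSeq h c xbar μ x d) ∧
        ∀ d : ℕ → EuclideanSpace ℝ (Fin n), ProxLinear.IsSmallCriticalSeq h c xbar μ x d →
          (∀ᶠ r in atTop, IsLocalMin (ProxLinear.proxObjective h c (x r) (μ r)) (d r)) ∧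
          (∀ d' : ℕ → EuclideanSpace ℝ (Fin n),
            ProxLinear.IsSmallCriticalSeq h c xbar μ x d' → ∀ᶠ r in atTop, d' r = d r) ∧
          ∀ᶠ r in atTop, ProxLinear.IdentifiesAndCorrects h c M γ (x r) (d r)) := by
  obtain ⟨vbar, hvbar, hA⟩ := hstrict
  have hvmem := intrinsicInterior_subset hvbar
  have hpr := hprox vbar hvmem
  have hlsc := hpr.2.1
  constructor
  · obtain ⟨ρ, hρ, hineq⟩ := hpr.exists_localProxInequality
    obtain ⟨γ, hγ, hprop⟩ := ProxLinear.exists_constant_small_critical_seq hc hps hcq hvbar hA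
      hlsc hρ.le hineq
    -- Existence dictates this threshold, with margin ε = 1; uniqueness and minimality need only
    -- ρ(‖A‖+1)².
    refine ⟨2 * ρ * (‖fderiv ℝ c xbar‖ + 1) ^ 2 + 1, by positivity, γ, hγ,
      fun μ x hμ hx hμx => ?_⟩
    obtain ⟨d, hd⟩ := ProxLinear.exists_small_critical_seq hc hps hcq hvmem hA hlsc hρ.le hineq
      one_pos (fun r => (hμ r).le) hx hμx
    obtain ⟨h1, h2, h3⟩ := hprop μ x (fun r => by
      have : 0 ≤ ρ * (‖fderiv ℝ c xbar‖ + 1) ^ 2 := by positivity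
      linarith [hμ r]) hx hμx d hd
    exact ⟨d, h1, hd, h2, h3⟩
  · intro hconv
    have hineq := hconv.localProxInequality (c xbar) vbar
    obtain ⟨γ, hγ, hprop⟩ := ProxLinear.exists_constant_small_critical_seq hc hps hcq hvbar hA
      hlsc le_rfl hineq
    -- With ρ = 0 the uniqueness threshold becomes μ > 0, while existence keeps the uniform margin ε
    -- ≤ μ.
    refine ⟨γ, hγ, fun μ x hμ hx hμx => ⟨?_, hprop μ x (fun r => by simpa using hμ r) hx hμx⟩⟩
    rintro ⟨ε, hε, hεμ⟩
    exact ProxLinear.exists_small_critical_seq hc hps hcq hvmem hA hlsc le_rfl hineq hε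
      (fun r => by simpa using hεμ r) hx hμx
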